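/- Let $q\ge 5$ be a prime power and let $N,M$ be positive integers with $NM=q-1$. Let $H=\mathbb F_{q^2}(x,y)$, $y^q+y=x^{q+1}$, be the Hermitian function field, whose genus is $g=(q^2-q)/2$, and let $P_\infty$ be the unique pole of $x$. Let $\delta$ be a primitive element of $\mathbb F_{q^2}$ and let $\sigma$ be the automorphism of $H/\mathbb F_{q^2}$ with $\sigma(x)=\delta x$ and $\sigma(y)=\delta^{q+1}y$; it has order $q^2-1$, and exactly $q$ orbits of the group $\langle\sigma\rangle$ on the rational places of $H$ consist of $q^2-1$ places. Let $P$ and $Q_{i,l}$ ($1\le i\le N$, $1\le l\le M$) be representatives of these $q=NM+1$ orbits, and let $z\in H$ be a function with pole divisor $(z)_\infty=kP_\infty+P$, where $k\le 2g-1$. For $1\le i\le N$ let $\mathbf s_i$ be the sequence of length $M(q^2-1)$ over $\mathbb F_{q^2}$ $$\mathbf s_i=\bigl(z(Q_{i,1}),z(\sigma(Q_{i,1})),\dots,z(\sigma^{q^2-2}(Q_{i,1})),\dots,z(Q_{i,M}),\dots,z(\sigma^{q^2-2}(Q_{i,M}))\bigr),$$ let $\mathcal S=\{\mathbf s_1,\dots,\mathbf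 s_N\}$, and let $\mathcal S_n$ be obtained from $\mathcal S$ by keeping the first $n$ terms of each sequence. For an integer $r\ge1$, the $r$th-order joint nonlinear complexity $N_r(\mathcal S_n)$ is $0$ if all terms of all sequences of $\mathcal S_n$ are $0$; otherwise it is the smallest integer $u\ge1$ for which there is a polynomial $f\in\mathbb F_{q^2}[x_1,\dots,x_u]$ of degree at most $r$ in each variable such that $s_i(j+u)=f(s_i(j),\dots,s_i(j+u-1))$ for all $0\le j\le n-u-1$ and all $1\le i\le N$, where $s_i(0),s_i(1),\dots$ are the terms of $\mathbf s_i$ (and $N_r(\mathcal S_n)=n$ if there is no such $f$). Then for every integer $r$ with $1\le r\le q^2-1$: (1) if $1<n\le q^2-1$, and either $nN>q^2-q$ or the terms of the sequences of $\mathcal S_n$ are not all $0$, then $$N_r(\mathcal S_n)\ \ge\ \frac{nN-1}{N+(q^2-q)r};$$ (2) if $q^2-1\le n\le M(q^2-1)$, then $$N_r(\mathcal S_n)\ \ge\ \frac{(q^2-1)N\lfloor n/(q^2-1)\rfloor-1}{N\lfloor n/(q^2-1)\rfloor+(q^2-q)r}.$$ -/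

import Mathlib

/-! ## Multisequences and joint nonlinear complexity -/

/-- The polynomial `f` in `u` variables generates the sequence `s` of length `n`:
`s(j+u) = f(s(j), …, s(j+u-1))` for all `0 ≤ j ≤ n-u-1`. -/
def GeneratesSeq {K : Type*} [CommRing K] {n u : ℕ} (f : MvPolynomial (Fin u) K)
    (s : Fin n → K) : Prop :=
  ∀ (j : ℕ) (hj : j + u < n),
    s ⟨j + u, hj⟩ =
      MvPolynomial.eval (fun t : Fin u => s ⟨j + t, lt_trans (Nat.add_lt_add_left t.2 j) hj⟩) f

/-- Some polynomial in `u` variables, of degree at most `r` in each variable, generates all the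
sequences `S i` simultaneously. -/
def JointlyGenerated {K ι : Type*} [CommRing K] {n : ℕ} (r : ℕ) (S : ι → Fin n → K)
    (u : ℕ) : Prop :=
  ∃ f : MvPolynomial (Fin u) K, (∀ t, f.degreeOf t ≤ r) ∧ ∀ i, GeneratesSeq f (S i)

open Classical in
/-- The `r`-th order joint nonlinear complexity `N_r(S)` of the family `S` of sequences of
length `n`: it is `0` if all the sequences are zero, otherwise the least `u ≥ 1` such that the
family is generated by a polynomial in `u` variables of degree at most `r` in each variable
(and `n` if there is none). -/
noncomputable def jointNonlinearComplexity {K ι : Type*} [CommRing K] {n : ℕ} (r : ℕ)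
    (S : ι → Fin n → K) : ℕ :=
  if ∀ i j, S i j = 0 then 0
  else if h : ∃ u, 1 ≤ u ∧ JointlyGenerated r S u then Nat.find h
  else n

/-- The first `n` terms of every sequence of a multisequence of length `L`. -/
def truncateSeq {K ι : Type*} {L : ℕ} (S : ι → Fin L → K) (n : ℕ) (hn : n ≤ L) :
    ι → Fin n → K :=
  fun i j => S i (Fin.castLE hn j)

/-! ## Places of a function field -/

/-- A place of `F / K`, given by its normalized discrete valuation `v : F → ℤ ∪ {∞}`, which is
trivial on the constants `K`. -/
@[ext]
structure FFPlace (K F : Type*) [Field K] [Field F] [Algebra K F] where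
  v : AddValuation F (WithTop ℤ)
  surjective : Function.Surjective v
  trivial_on_constants : ∀ c : K, c ≠ 0 → v (algebraMap K F c) = 0

namespace FFPlace

variable {K F : Type*} [Field K] [Field F] [Algebra K F]

/-- The place is rational (of degree one): every element of its local ring is congruent to a
constant modulo the maximal ideal, i.e. the residue class field is `K`. -/
def IsRational (P : FFPlace K F) : Prop :=
  ∀ z : F, 0 ≤ P.v z → ∃ c : K, 0 < P.v (z - algebraMap K F c)

open Classical in
/-- The value `z(P) ∈ K` of `z` at a rational place `P` which is not a pole of `z`: the constant
`c` with `v_P(z - c) > 0`. The value `0` is assigned if there is no such `c`. -/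
noncomputable def eval (P : FFPlace K F) (z : F) : K :=
  if h : ∃ c : K, 0 < P.v (z - algebraMap K F c) then h.choose else 0

/-- The multiplicity `max(0, -v_P(z))` of `P` in the pole divisor of `z`. -/
def poleOrder (P : FFPlace K F) (z : F) : ℤ :=
  max 0 (-((P.v z).untopD 0))

/-- `D` is the pole divisor `(z)_∞` of the nonzero function `z`. -/
def IsPoleDivisor (z : F) (D : FFPlace K F →₀ ℤ) : Prop :=
  z ≠ 0 ∧ ∀ P : FFPlace K F, D P = P.poleOrder z

/-- Automorphisms of `F / K` act on the places by `v_{σ(P)}(w) = v_P(σ⁻¹(w))`. -/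
instance : MulAction (F ≃ₐ[K] F) (FFPlace K F) where
  smul σ P :=
    { v := P.v.comap ((σ⁻¹ : F ≃ₐ[K] F) : F →+* F)
      surjective := P.surjective.comp (σ⁻¹ : F ≃ₐ[K] F).surjective
      trivial_on_constants := fun c hc => by
        have h : (σ⁻¹ : F ≃ₐ[K] F) (algebraMap K F c) = algebraMap K F c :=
          (σ⁻¹ : F ≃ₐ[K] F).commutes c
        change P.v ((σ⁻¹ : F ≃ₐ[K] F) (algebraMap K F c)) = 0
        rw [h]
        exact P.trivial_on_constants c hc }
  one_smul P := by
    apply FFPlace.ext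
    rfl
  mul_smul σ τ P := by
    apply FFPlace.ext
    refine AddValuation.ext fun w => ?_
    change P.v ((σ * τ)⁻¹ w) = P.v (τ⁻¹ (σ⁻¹ w))
    rw [mul_inv_rev]
    rfl

theorem smul_v_apply (σ : F ≃ₐ[K] F) (P : FFPlace K F) (w : F) :
    (σ • P).v w = P.v (σ⁻¹ w) := rfl

end FFPlace

/-! ## The Hermitian function field -/

namespace Hermitian

/-- The polynomial `x ^ (q+1) - (y ^ q + y)`, as a polynomial in `x` over `K[y]`. -/
noncomputable def polynomial (K : Type*) [Field K] (q : ℕ) : Polynomial (Polynomial K) :=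
  Polynomial.X ^ (q + 1) - Polynomial.C (Polynomial.X ^ q + Polynomial.X)

theorem polynomial_prime (K : Type*) [Field K] (q : ℕ) (hq : 1 < q) :
    Prime (polynomial K q) := by
  have hmonic : (polynomial K q).Monic := Polynomial.monic_X_pow_sub_C _ (Nat.succ_ne_zero q)
  have hdeg : (polynomial K q).degree = ((q + 1 : ℕ) : WithBot ℕ) :=
    Polynomial.degree_X_pow_sub_C (Nat.succ_pos q) _
  have hX : (Ideal.span {(Polynomial.X : Polynomial K)}).IsPrime :=
    (Ideal.span_singleton_prime Polynomial.X_ne_zero).2 Polynomial.prime_X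
  refine Irreducible.prime (Polynomial.irreducible_of_eisenstein_criterion hX ?_ ?_ ?_ ?_
    hmonic.isPrimitive)
  · rw [hmonic.leadingCoeff]
    exact fun h => hX.ne_top ((Ideal.eq_top_iff_one _).2 h)
  · intro n hn
    rw [hdeg] at hn
    have hn' : n < q + 1 := by exact_mod_cast hn
    rw [polynomial, Polynomial.coeff_sub, Polynomial.coeff_X_pow, if_neg hn'.ne, zero_sub,
      neg_mem_iff, Polynomial.coeff_C, Ideal.mem_span_singleton]
    split_ifs
    · exact dvd_add (dvd_pow_self _ (by omega)) dvd_rfl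
    · exact dvd_zero _
  · rw [hdeg]
    exact_mod_cast Nat.succ_pos q
  · rw [polynomial, Polynomial.coeff_sub, Polynomial.coeff_X_pow, if_neg (Nat.succ_ne_zero q).symm,
      zero_sub, neg_mem_iff, Polynomial.coeff_C_zero, Ideal.span_singleton_pow,
      Ideal.mem_span_singleton, Polynomial.X_pow_dvd_iff]
    intro h
    have h1 := h 1 (by norm_num)
    rw [Polynomial.coeff_add, Polynomial.coeff_X_pow, if_neg hq.ne, Polynomial.coeff_X_one,
      zero_add] at h1
    exact one_ne_zero h1

/-- The coordinate ring `K[x, y] / (x ^ (q+1) - y ^ q - y)`. -/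
abbrev CoordinateRing (K : Type*) [Field K] (q : ℕ) : Type _ :=
  AdjoinRoot (polynomial K q)

instance (K : Type*) [Field K] (q : ℕ) [hq : Fact (IsPrimePow q)] :
    IsDomain (CoordinateRing K q) :=
  AdjoinRoot.isDomain_of_prime (polynomial_prime K q hq.out.one_lt)

/-- The Hermitian function field `K(x, y)`, `y ^ q + y = x ^ (q+1)`
(where `K` is the field with `q ^ 2` elements). -/
abbrev FunctionField (K : Type*) [Field K] (q : ℕ) : Type _ :=
  FractionRing (CoordinateRing K q)

/-- The function `x` of the Hermitian function field. -/
noncomputable def x (K : Type*) [Field K] (q : ℕ) : FunctionField K q :=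
  algebraMap (CoordinateRing K q) (FunctionField K q) (AdjoinRoot.root (polynomial K q))

/-- The function `y` of the Hermitian function field. -/
noncomputable def y (K : Type*) [Field K] (q : ℕ) : FunctionField K q :=
  algebraMap (CoordinateRing K q) (FunctionField K q)
    (AdjoinRoot.of (polynomial K q) Polynomial.X)

theorem equation (K : Type*) [Field K] (q : ℕ) :
    y K q ^ q + y K q = x K q ^ (q + 1) := by
  have h := AdjoinRoot.eval₂_root (polynomial K q)
  rw [polynomial, Polynomial.eval₂_sub, Polynomial.eval₂_X_pow, Polynomial.eval₂_C] at h
  rw [x, y, ← map_pow, ← map_pow, ← map_add, ← map_pow, ← map_add]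
  exact congrArg _ (sub_eq_zero.1 h).symm

/-- The multisequence `s_1, …, s_N` of length `M (q²-1)`, where `s_i` lists the values of `z` at
`Q_{i,1}, σ(Q_{i,1}), …, σ^{q²-2}(Q_{i,1}), …, Q_{i,M}, …, σ^{q²-2}(Q_{i,M})` in this order. -/
noncomputable def multisequence {K F : Type*} [Field K] [Field F] [Algebra K F] {N M : ℕ}
    (q : ℕ) (σ : F ≃ₐ[K] F) (Q : Fin N → Fin M → FFPlace K F) (z : F) :
    Fin N → Fin (M * (q ^ 2 - 1)) → K :=
  fun i j => (σ ^ (j.modNat : ℕ) • Q i j.divNat).eval z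

end Hermitian

/-! A recursion f of order u makes h = σ⁻ᵘ(z) - f(z, σ⁻¹(z), …, σ^{-(u-1)}(z)) vanish at σʲ(Q_{i,l})
whenever entries j, …, j+u lie in the block of Q_{i,l}, because σ⁻ᵗ(z) takes at R the value of z at
σᵗ(R). With m blocks of length B this gives Nm(B-u) distinct rational zeros. On the other hand h ≠
0, since σ⁻ᵘ(P) is a pole of the first term only, and the poles of h are at most P_∞ (order max(k,
ruk)), the σ⁻ᵗ(P) with t < u (order r each) and σ⁻ᵘ(P) (order 1). For u ≥ 1 this yields Nm(B-u) ≤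
ru(k+1)+1 ≤ ru(q²-q)+1, because k+1 ≤ 2g. Solving for u gives both bounds, with (m, B) = (1, n) and
(⌊n/(q²-1)⌋, q²-1).

That zeros do not outnumber poles (`FFPlace.card_zeros_le`) is a dimension count in the spaces L(a)
of functions whose only pole is P_∞, of order at most a. Multiplication by h embeds the functions of
L(b) that cancel the poles of h outside P_∞ into the functions of L(b+d) that vanish at the zeros,
where d bounds the pole order at P_∞. Comparing codimensions requires two facts about the curve.

Functions regular away from P_∞ separate places: x - a is a uniformizer at every affine point (a,
b), so a place is determined by its point (`Hermitian.place_eq_of_point`). The functions x/y and 1/y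
satisfy the same equation as x and y, so the same argument at (0, 0) shows that P_∞ is unique and
rational.

L(-1) = 0 (`Hermitian.regularAway_inf_eq_bot`): a function in L(-1) is integral over K[y], and its
norm for the Galois extension of K(y) is a polynomial in y vanishing at the pole P_∞ of y, hence
zero. -/

namespace FFPlace

variable {K F : Type*} [Field K] [Field F] [Algebra K F]

/-! ### Zeros against poles, by counting dimensions -/

theorem v_algebraMap_nonneg (P : FFPlace K F) (c : K) : 0 ≤ P.v (algebraMap K F c) := by
  by_cases hc : c = 0
  · simp [hc]
  · rw [P.trivial_on_constants c hc]

theorem v_eval_sub_pos {P : FFPlace K F} (hP : P.IsRational) {z : F} (hz : 0 ≤ P.v z) :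
    0 < P.v (z - algebraMap K F (P.eval z)) := by
  have h := hP z hz
  rw [eval, dif_pos h]
  exact h.choose_spec

theorem v_ne_top (P : FFPlace K F) {z : F} (hz : z ≠ 0) : P.v z ≠ ⊤ :=
  fun h => hz (P.v.top_iff.1 h)

theorem v_inv_add (P : FFPlace K F) {z : F} (hz : z ≠ 0) : P.v z⁻¹ + P.v z = 0 := by
  rw [← P.v.map_mul, inv_mul_cancel₀ hz, P.v.map_one]

/-- The functions of valuation at least `m` at `P`. -/
def geSubmodule (P : FFPlace K F) (m : ℤ) : Submodule K F where
  carrier := {w | (m : WithTop ℤ) ≤ P.v w}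
  add_mem' := fun ha hb => P.v.map_le_add ha hb
  zero_mem' := by simp
  smul_mem' := fun c w hw => by
    simp only [Set.mem_ofPred_eq] at hw ⊢
    rw [Algebra.smul_def, P.v.map_mul]
    calc (m : WithTop ℤ) = 0 + m := (zero_add _).symm
      _ ≤ _ := add_le_add (P.v_algebraMap_nonneg c) hw

theorem mem_geSubmodule {P : FFPlace K F} {m : ℤ} {w : F} :
    w ∈ P.geSubmodule m ↔ (m : WithTop ℤ) ≤ P.v w := Iff.rfl

theorem add_one_le_iff {m : ℤ} {a : WithTop ℤ} :
    ((m + 1 : ℤ) : WithTop ℤ) ≤ a ↔ (m : WithTop ℤ) < a := by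
  cases a with
  | top => simp
  | coe a =>
    rw [WithTop.coe_le_coe, WithTop.coe_lt_coe]
    omega

theorem mem_geSubmodule_one {P : FFPlace K F} {w : F} :
    w ∈ P.geSubmodule 1 ↔ 0 < P.v w := by
  rw [mem_geSubmodule, show (1 : ℤ) = 0 + 1 by rfl, add_one_le_iff]
  rfl

theorem geSubmodule_anti (P : FFPlace K F) {m n : ℤ} (h : m ≤ n) :
    P.geSubmodule n ≤ P.geSubmodule m :=
  fun _ hw => le_trans (WithTop.coe_le_coe.2 h) (mem_geSubmodule.1 hw)

/-- Raising the order of vanishing at a rational place by one cuts out a subspace of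
codimension at most one. -/
theorem exists_inf_geSubmodule_le {P : FFPlace K F} (hP : P.IsRational) (W : Submodule K F)
    (m : ℤ) : ∃ w₀ : F,
      W ⊓ P.geSubmodule m ≤ (W ⊓ P.geSubmodule (m + 1)) ⊔ Submodule.span K {w₀} := by
  by_cases hex : ∃ w₀ ∈ W, P.v w₀ = m
  · obtain ⟨w₀, hw₀, hv₀⟩ := hex
    have hne : w₀ ≠ 0 := by
      rintro rfl
      simp at hv₀
    refine ⟨w₀, fun w hw => ?_⟩
    have hq : 0 ≤ P.v (w * w₀⁻¹) := by
      have h1 := P.v_inv_add hne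
      rw [hv₀] at h1
      rw [P.v.map_mul, ← h1, add_comm]
      exact add_le_add hw.2 le_rfl
    set c := P.eval (w * w₀⁻¹) with hc
    have hlt := v_eval_sub_pos hP hq
    rw [← hc] at hlt
    have hsub : w - c • w₀ = (w * w₀⁻¹ - algebraMap K F c) * w₀ := by
      rw [sub_mul, Algebra.smul_def, mul_assoc, inv_mul_cancel₀ hne, mul_one]
    have hmem : w - c • w₀ ∈ W ⊓ P.geSubmodule (m + 1) := by
      refine ⟨W.sub_mem hw.1 (W.smul_mem c hw₀), ?_⟩
      change ((m + 1 : ℤ) : WithTop ℤ) ≤ P.v _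
      rw [hsub, P.v.map_mul, hv₀, add_comm m 1, WithTop.coe_add]
      exact add_le_add (mem_geSubmodule_one.2 hlt) le_rfl
    rw [show w = (w - c • w₀) + c • w₀ by ring]
    exact Submodule.add_mem_sup hmem
      (Submodule.smul_mem _ _ (Submodule.mem_span_singleton_self w₀))
  · push Not at hex
    refine ⟨0, fun w hw => le_sup_left (a := W ⊓ P.geSubmodule (m + 1)) ⟨hw.1, ?_⟩⟩
    exact add_one_le_iff.2 (lt_of_le_of_ne hw.2 (hex w hw.1).symm)

/-- Finiteness travels from high vanishing order to low, one dimension per step. Starting at L(-1) =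
0 this makes every L(a) finite-dimensional. -/
theorem finite_inf_geSubmodule {P : FFPlace K F} (hP : P.IsRational) (W : Submodule K F)
    {m : ℤ} (n : ℕ) (h : FiniteDimensional K ↥(W ⊓ P.geSubmodule (m + n))) :
    FiniteDimensional K ↥(W ⊓ P.geSubmodule m) ∧
      Module.finrank K ↥(W ⊓ P.geSubmodule m) ≤
        Module.finrank K ↥(W ⊓ P.geSubmodule (m + n)) + n := by
  induction n with
  | zero =>
    have h0 : m + ((0 : ℕ) : ℤ) = m := by simp
    rw [h0] at h ⊢
    exact ⟨h, le_rfl⟩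
  | succ n ih =>
    rw [show m + ((n + 1 : ℕ) : ℤ) = m + n + 1 by push_cast; ring] at h ⊢
    obtain ⟨w₀, hw₀⟩ := exists_inf_geSubmodule_le hP W (m + n)
    have hfin : FiniteDimensional K ↥(W ⊓ P.geSubmodule (m + n)) :=
      Submodule.finiteDimensional_of_le hw₀
    obtain ⟨h1, h2⟩ := ih hfin
    refine ⟨h1, h2.trans ?_⟩
    have h3 := (Submodule.finrank_mono hw₀).trans (Submodule.finrank_add_le_finrank_add_finrank _ _)
    have h4 := finrank_span_le_card (R := K) ({w₀} : Set F)
    simp only [Set.toFinset_singleton, Finset.card_singleton] at h4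
    omega

/-- The functions which are regular at all places other than `P₀`. -/
def regularAway (P₀ : FFPlace K F) : Submodule K F where
  carrier := {w | ∀ Q, Q ≠ P₀ → 0 ≤ Q.v w}
  add_mem' := fun ha hb Q hQ => Q.v.map_le_add (ha Q hQ) (hb Q hQ)
  zero_mem' := by simp
  smul_mem' := fun c w hw Q hQ => by
    rw [Algebra.smul_def, Q.v.map_mul]
    exact add_nonneg (Q.v_algebraMap_nonneg c) (hw Q hQ)

theorem exists_neg_natCast_le (P : FFPlace K F) (w : F) :
    ∃ m : ℕ, ((-(m : ℤ) : ℤ) : WithTop ℤ) ≤ P.v w := by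
  cases P.v w with
  | top => exact ⟨0, le_top⟩
  | coe a => exact ⟨a.natAbs, WithTop.coe_le_coe.2 (by omega)⟩

/-- The upper bound on codimension, for the conditions that cancel poles: each additional order of
vanishing costs at most one dimension. -/
theorem finrank_le_finrank_inf_geSubmodule {W : Submodule K F} [FiniteDimensional K W]
    (E : Finset (FFPlace K F)) (e : FFPlace K F → ℕ) (hE : ∀ Q ∈ E, Q.IsRational)
    (hW : ∀ Q ∈ E, W ≤ Q.geSubmodule 0) :
    Module.finrank K W ≤
      Module.finrank K ↥(W ⊓ ⨅ Q ∈ E, Q.geSubmodule (e Q)) + ∑ Q ∈ E, e Q := by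
  classical
  induction E using Finset.induction_on with
  | empty =>
    rw [show (W ⊓ ⨅ Q ∈ (∅ : Finset (FFPlace K F)), Q.geSubmodule (e Q)) = W by simp]
    exact Nat.le_add_right _ _
  | insert Q E hQ ih =>
    specialize ih (fun R hR => hE R (Finset.mem_insert_of_mem hR))
      (fun R hR => hW R (Finset.mem_insert_of_mem hR))
    set V := W ⊓ ⨅ Q ∈ E, Q.geSubmodule (e Q) with hV
    have hVW : V ≤ W := inf_le_left
    have hfin : FiniteDimensional K V := Submodule.finiteDimensional_of_le hVW
    have hV0 : V ⊓ Q.geSubmodule 0 = V :=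
      inf_eq_left.2 (hVW.trans (hW Q (Finset.mem_insert_self Q E)))
    have h := (finite_inf_geSubmodule (hE Q (Finset.mem_insert_self Q E)) V (m := 0) (e Q)
      (Submodule.finiteDimensional_of_le inf_le_left)).2
    rw [hV0, zero_add] at h
    rw [Finset.sum_insert hQ, Finset.iInf_insert, inf_comm (Q.geSubmodule _), ← inf_assoc, ← hV]
    omega

/-- The lower bound on codimension, for the conditions at the zeros: `g Q` satisfies the conditions
at the other places but not the one at `Q`, so every new condition cuts the dimension strictly. -/
theorem finrank_inf_geSubmodule_one_add_card_le {W : Submodule K F} [FiniteDimensional K W]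
    (Z : Finset (FFPlace K F)) (g : FFPlace K F → F) (hgW : ∀ Q ∈ Z, g Q ∈ W)
    (hg0 : ∀ Q ∈ Z, ¬ 0 < Q.v (g Q)) (hg1 : ∀ Q ∈ Z, ∀ R ∈ Z, R ≠ Q → 0 < R.v (g Q)) :
    Module.finrank K ↥(W ⊓ ⨅ Q ∈ Z, Q.geSubmodule 1) + Z.card ≤ Module.finrank K W := by
  classical
  induction Z using Finset.induction_on with
  | empty =>
    rw [show (W ⊓ ⨅ Q ∈ (∅ : Finset (FFPlace K F)), Q.geSubmodule 1) = W by simp]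
    exact le_rfl
  | insert Q Z hQ ih =>
    specialize ih (fun R hR => hgW R (Finset.mem_insert_of_mem hR))
      (fun R hR => hg0 R (Finset.mem_insert_of_mem hR))
      (fun R hR S hS => hg1 R (Finset.mem_insert_of_mem hR) S (Finset.mem_insert_of_mem hS))
    have hQm := Finset.mem_insert_self Q Z
    set V := W ⊓ ⨅ Q ∈ Z, Q.geSubmodule 1 with hV
    have hfin : FiniteDimensional K V := Submodule.finiteDimensional_of_le inf_le_left
    rw [Finset.card_insert_of_notMem hQ, Finset.iInf_insert, inf_comm (Q.geSubmodule _),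
      ← inf_assoc, ← hV]
    have hlt : V ⊓ Q.geSubmodule 1 < V := by
      refine lt_of_le_of_ne inf_le_left fun heq => ?_
      have hmem : g Q ∈ V := by
        refine ⟨hgW Q hQm, ?_⟩
        simp only [SetLike.mem_coe, Submodule.mem_iInf]
        exact fun R hR => mem_geSubmodule_one.2 (hg1 Q hQm R (Finset.mem_insert_of_mem hR)
          (fun h => hQ (h ▸ hR)))
      rw [← heq] at hmem
      exact hg0 Q hQm (mem_geSubmodule_one.1 hmem.2)
    have := Submodule.finrank_lt_finrank_of_lt hlt
    omega

/-- If the functions regular away from the rational place `P₀` separate the rational places and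
none of them vanishes at `P₀`, then a nonzero function has at most as many rational zeros as the
degree of its pole divisor, supposed to be supported on rational places. -/
theorem card_zeros_le {P₀ : FFPlace K F} (hP₀ : P₀.IsRational)
    (hbot : P₀.regularAway ⊓ P₀.geSubmodule 1 = ⊥)
    (hsep : ∀ Q R : FFPlace K F, R.IsRational → R ≠ P₀ → R ≠ Q →
      ∃ g ∈ P₀.regularAway, ¬ 0 < Q.v g ∧ 0 < R.v g)
    {h : F} (hh : h ≠ 0) (Z E : Finset (FFPlace K F)) (e : FFPlace K F → ℕ) (d : ℕ)
    (hE : ∀ Q ∈ E, Q.IsRational) (hE₀ : P₀ ∉ E)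
    (hZ : ∀ Q ∈ Z, Q.IsRational) (hZ₀ : P₀ ∉ Z) (hZh : ∀ Q ∈ Z, 0 < Q.v h)
    (hd : ((-(d : ℤ) : ℤ) : WithTop ℤ) ≤ P₀.v h)
    (he : ∀ Q ∈ E, ((-(e Q : ℤ) : ℤ) : WithTop ℤ) ≤ Q.v h)
    (hreg : ∀ Q, Q ∉ E → Q ≠ P₀ → 0 ≤ Q.v h) :
    Z.card ≤ d + ∑ Q ∈ E, e Q := by
  classical
  have hg : ∀ Q : FFPlace K F, ∃ g : F, Q ∈ Z → g ∈ P₀.regularAway ∧ ¬ 0 < Q.v g ∧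
      ∀ R ∈ Z, R ≠ Q → 0 < R.v g := by
    intro Q
    by_cases hQ : Q ∈ Z
    · have : ∀ R : FFPlace K F, ∃ g : F, R ∈ Z.erase Q → g ∈ P₀.regularAway ∧ ¬ 0 < Q.v g ∧
          0 < R.v g := by
        intro R
        by_cases hR : R ∈ Z.erase Q
        · have hR' := Finset.mem_erase.1 hR
          obtain ⟨g, hg⟩ := hsep Q R (hZ R hR'.2)
            (fun h => hZ₀ (h ▸ hR'.2)) hR'.1
          exact ⟨g, fun _ => hg⟩
        · exact ⟨0, fun h => absurd h hR⟩
      choose g hg using this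
      have hprod : ∀ R : FFPlace K F, R.v (∏ S ∈ Z.erase Q, g S) =
          ∑ S ∈ Z.erase Q, R.v (g S) := by
        intro R
        induction Z.erase Q using Finset.induction_on with
        | empty => simp
        | insert S T hS ih => rw [Finset.prod_insert hS, Finset.sum_insert hS, R.v.map_mul, ih]
      -- The product of the functions separating `Q` from each other `R` vanishes at all of them and
      -- still not at `Q`.
      refine ⟨∏ R ∈ Z.erase Q, g R, fun _ => ⟨fun R hR => ?_, ?_, fun R hR hRQ => ?_⟩⟩
      · rw [hprod]
        exact Finset.sum_nonneg fun S hS => (hg S hS).1 R hR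
      · rw [hprod, not_lt]
        exact Finset.sum_nonpos fun S hS => not_lt.1 (hg S hS).2.1
      · have hR' := Finset.mem_erase.2 ⟨hRQ, hR⟩
        rw [hprod, ← Finset.add_sum_erase _ _ hR']
        exact lt_of_lt_of_le (hg R hR').2.2 (le_add_of_nonneg_right
          (Finset.sum_nonneg fun S hS => (hg S (Finset.mem_of_mem_erase hS)).1 R
            (fun h => hZ₀ (h ▸ hR))))
    · exact ⟨0, fun h => absurd h hQ⟩
  choose g hg using hg
  choose m hm using fun Q => exists_neg_natCast_le P₀ (g Q)
  -- Any b with all separating functions in L(b) will do; the sum of their pole orders is a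
  -- convenient one.
  set b := ∑ Q ∈ Z, m Q with hb
  set L : ℕ → Submodule K F := fun a => P₀.regularAway ⊓ P₀.geSubmodule (-(a : ℤ)) with hL
  have hfin : ∀ a, FiniteDimensional K (L a) := fun a =>
    (finite_inf_geSubmodule hP₀ P₀.regularAway (m := -(a : ℤ)) (a + 1) (by
      rw [show (-(a : ℤ) + ((a + 1 : ℕ) : ℤ)) = 1 by push_cast; ring, hbot]
      infer_instance)).1
  have hgrow : Module.finrank K (L (b + d)) ≤ Module.finrank K (L b) + d := by
    have := (finite_inf_geSubmodule hP₀ P₀.regularAway (m := -((b + d : ℕ) : ℤ)) d (by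
      rw [show (-((b + d : ℕ) : ℤ) + (d : ℤ)) = -(b : ℤ) by push_cast; ring]
      exact hfin b)).2
    rwa [show (-((b + d : ℕ) : ℤ) + (d : ℤ)) = -(b : ℤ) by push_cast; ring] at this
  have hfinb := hfin b
  have hfinbd := hfin (b + d)
  have h1 := finrank_le_finrank_inf_geSubmodule (W := L b) E e hE
    (fun Q hQ w hw => hw.1 Q (fun h => hE₀ (h ▸ hQ)))
  have h2 := finrank_inf_geSubmodule_one_add_card_le (W := L (b + d)) Z g
    (fun Q hQ => ⟨(hg Q hQ).1, geSubmodule_anti P₀ (by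
      have := Finset.single_le_sum (f := m) (fun _ _ => Nat.zero_le _) hQ
      push_cast
      omega) (hm Q)⟩) (fun Q hQ => (hg Q hQ).2.1) (fun Q hQ => (hg Q hQ).2.2)
  set V := L b ⊓ ⨅ Q ∈ E, Q.geSubmodule (e Q) with hV
  set U := L (b + d) ⊓ ⨅ Q ∈ Z, Q.geSubmodule 1 with hU
  have hfinU : FiniteDimensional K U := Submodule.finiteDimensional_of_le inf_le_left
  -- The zeros of w at `E` absorb the poles of `h` there, the pole orders at `P₀` add up to b + d,
  -- and the zeros of `h` survive since w has no pole in `Z`.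
  have hmul : V.map (LinearMap.mulLeft K h) ≤ U := by
    rintro _ ⟨w, hw, rfl⟩
    have hwE : ∀ Q ∈ E, ((e Q : ℤ) : WithTop ℤ) ≤ Q.v w := by
      have := hw.2
      simp only [SetLike.mem_coe, Submodule.mem_iInf] at this
      exact this
    rw [LinearMap.mulLeft_apply]
    refine ⟨⟨fun Q hQ => ?_, ?_⟩, ?_⟩
    · rw [Q.v.map_mul]
      by_cases hQE : Q ∈ E
      · calc (0 : WithTop ℤ) = ((-(e Q : ℤ) : ℤ) : WithTop ℤ) + ((e Q : ℤ) : WithTop ℤ) := by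
              rw [← WithTop.coe_add, neg_add_cancel]; rfl
          _ ≤ _ := add_le_add (he Q hQE) (hwE Q hQE)
      · exact add_nonneg (hreg Q hQE hQ) (hw.1.1 Q hQ)
    · change _ ≤ P₀.v _
      rw [P₀.v.map_mul, show (-((b + d : ℕ) : ℤ)) = -(d : ℤ) + -(b : ℤ) by push_cast; ring,
        WithTop.coe_add]
      exact add_le_add hd hw.1.2
    · simp only [SetLike.mem_coe, Submodule.mem_iInf]
      intro Q hQ
      rw [mem_geSubmodule_one, Q.v.map_mul]
      exact lt_of_lt_of_le (hZh Q hQ)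
        (le_add_of_nonneg_right (hw.1.1 Q (fun h => hZ₀ (h ▸ hQ))))
  have h3 := Submodule.finrank_mono hmul
  rw [← (Submodule.equivMapOfInjective (LinearMap.mulLeft K h)
    (mul_right_injective₀ hh) V).finrank_eq] at h3
  -- dim L(b) - Σ e ≤ dim V ≤ dim U ≤ dim L(b+d) - |Z| ≤ dim L(b) + d - |Z|.
  omega

end FFPlace

/-! ### Local structure at a point of the curve -/

namespace FFPlace

variable {K F : Type*} [Field K] [Field F] [Algebra K F]

theorem v_aeval_sub_pos (P : FFPlace K F) {ι : Type*} {z : ι → F} {s : ι → K}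
    (h : ∀ i, 0 < P.v (z i - algebraMap K F (s i))) (p : MvPolynomial ι K) :
    0 < P.v (MvPolynomial.aeval z p - algebraMap K F (MvPolynomial.eval s p)) := by
  have hz : ∀ i, 0 ≤ P.v (z i) := fun i => by
    rw [← sub_add_cancel (z i) (algebraMap K F (s i))]
    exact P.v.map_le_add (h i).le (P.v_algebraMap_nonneg _)
  induction p using MvPolynomial.induction_on with
  | C c => simp
  | add p p' hp hp' =>
    rw [map_add, map_add, map_add, add_sub_add_comm]
    exact P.v.map_lt_add hp hp'
  | mul_X p i hp =>
    rw [map_mul, map_mul, map_mul, MvPolynomial.aeval_X, MvPolynomial.eval_X,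
      show ∀ a b c d : F, a * b - c * d = (a - c) * b + c * (b - d) by intros; ring]
    refine P.v.map_lt_add ?_ ?_
    · rw [P.v.map_mul]
      exact lt_of_lt_of_le hp (le_add_of_nonneg_right (hz i))
    · rw [P.v.map_mul]
      exact lt_of_lt_of_le (h i) (le_add_of_nonneg_left (P.v_algebraMap_nonneg _))

theorem v_eq_zero_of_sub_pos (P : FFPlace K F) {w : F} {c : K} (hc : c ≠ 0)
    (h : 0 < P.v (w - algebraMap K F c)) : P.v w = 0 := by
  rw [← sub_add_cancel w (algebraMap K F c), ← P.trivial_on_constants c hc]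
  exact P.v.map_add_eq_of_lt_right (by rwa [P.trivial_on_constants c hc])

end FFPlace

namespace Hermitian

open MvPolynomial

variable {K F : Type*} [Field K] [Field F] [Algebra K F] {p m q : ℕ} {X Y : F} {a b : K}

section Local

variable (P : FFPlace K F)

theorem point_equation (hXY : Y ^ q + Y = X ^ (q + 1))
    (hX : 0 < P.v (X - algebraMap K F a)) (hY : 0 < P.v (Y - algebraMap K F b)) :
    b ^ q + b = a ^ (q + 1) := by
  have h := P.v_aeval_sub_pos (z := ![X, Y]) (s := ![a, b])
    (fun i => by fin_cases i <;> simpa using ‹_›)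
    (MvPolynomial.X 1 ^ q + MvPolynomial.X 1 - MvPolynomial.X 0 ^ (q + 1))
  simp only [map_sub, map_add, map_pow, aeval_X, eval_X, Matrix.cons_val_zero,
    Matrix.cons_val_one] at h
  rw [hXY, sub_self, zero_sub, P.v.map_neg] at h
  by_contra hne
  rw [← map_pow, ← map_pow, ← map_add, ← map_sub,
    P.trivial_on_constants _ (sub_ne_zero.2 hne)] at h
  exact lt_irrefl _ h

/-- Smoothness in explicit form: the equation has derivative 1 in Y, so Y - b is a multiple of X - a
up to the factor 1 + (Y - b)^(q-1), a unit at the point. The property passes to sums and products.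
-/
theorem sub_eval_mul_eq [CharP F p] [Fact p.Prime] (hq : q = p ^ m)
    (hXY : Y ^ q + Y = X ^ (q + 1)) (hab : b ^ q + b = a ^ (q + 1))
    (f : MvPolynomial (Fin 2) K) :
    ∃ g : MvPolynomial (Fin 2) K,
      (aeval ![X, Y] f - algebraMap K F (eval ![a, b] f)) *
        (1 + (Y - algebraMap K F b) ^ (q - 1)) =
      (X - algebraMap K F a) * aeval ![X, Y] g := by
  have hq0 : q ≠ 0 := by
    rw [hq]
    exact pow_ne_zero _ (Fact.out : p.Prime).ne_zero
  induction f using MvPolynomial.induction_on with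
  | C c => exact ⟨0, by simp⟩
  | add f f' hf hf' =>
    obtain ⟨g, hg⟩ := hf
    obtain ⟨g', hg'⟩ := hf'
    refine ⟨g + g', ?_⟩
    rw [map_add, map_add, map_add, map_add]
    linear_combination hg + hg'
  | mul_X f i hf =>
    obtain ⟨g, hg⟩ := hf
    have hi : ∃ g' : MvPolynomial (Fin 2) K,
        (![X, Y] i - algebraMap K F (![a, b] i)) * (1 + (Y - algebraMap K F b) ^ (q - 1)) =
          (X - algebraMap K F a) * aeval ![X, Y] g' := by
      fin_cases i
      · refine ⟨1 + (MvPolynomial.X 1 - C b) ^ (q - 1), ?_⟩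
        simp
      -- In characteristic p, (Y - b) + (Y - b)^q = (Y^q + Y) - (b^q + b) = X^(q+1) - a^(q+1); the
      -- witness is the geometric-sum cofactor of X - a.
      · refine ⟨∑ i ∈ Finset.range (q + 1), MvPolynomial.X 0 ^ i * C a ^ (q + 1 - 1 - i), ?_⟩
        have h1 := (Commute.all X (algebraMap K F a)).geom_sum₂_mul (q + 1)
        have h2 : (Y - algebraMap K F b) ^ q = Y ^ q - algebraMap K F b ^ q := by
          rw [hq]
          exact sub_pow_char_pow Y (algebraMap K F b) m
        simp only [Fin.mk_one, Matrix.cons_val_one, Matrix.cons_val_fin_one, map_sum, map_mul,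
          map_pow, aeval_X, Matrix.cons_val_zero, algHom_C]
        rw [mul_comm (X - _), h1, mul_add, mul_one, mul_pow_sub_one hq0, h2, ← hXY, ← map_pow,
          ← map_pow, ← hab, map_add]
        ring
    obtain ⟨g', hg'⟩ := hi
    refine ⟨g * MvPolynomial.X i + C (eval ![a, b] f) * g', ?_⟩
    rw [map_mul, map_mul, map_mul, map_add, map_mul, map_mul, aeval_X, eval_X, aeval_C]
    linear_combination ![X, Y] i * hg + algebraMap K F (eval ![a, b] f) * hg'

variable [CharP F p] [Fact p.Prime] (hq : q = p ^ m) (hq1 : 1 < q)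
  (hXY : Y ^ q + Y = X ^ (q + 1))
  (hX : 0 < P.v (X - algebraMap K F a)) (hY : 0 < P.v (Y - algebraMap K F b))

include hX hY in
theorem v_aeval_eq_zero {f : MvPolynomial (Fin 2) K} (hf : eval ![a, b] f ≠ 0) :
    P.v (aeval ![X, Y] f) = 0 :=
  P.v_eq_zero_of_sub_pos hf (P.v_aeval_sub_pos
    (fun i => by fin_cases i <;> simpa using ‹_›) f)

include hq hq1 hXY hX hY in
-- While the polynomial vanishes at (a, b), a factor X - a can be stripped off up to a unit. Each
-- factor has value at least 1, so the bound `N` stops the process.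
theorem exists_local_form_of_le (N : ℕ) (f : MvPolynomial (Fin 2) K)
    (hf : P.v (aeval ![X, Y] f) ≤ (N : ℤ)) :
    ∃ (n : ℕ) (f₁ f₂ : MvPolynomial (Fin 2) K), eval ![a, b] f₁ ≠ 0 ∧ eval ![a, b] f₂ ≠ 0 ∧
      aeval ![X, Y] f * aeval ![X, Y] f₁ =
        (X - algebraMap K F a) ^ n * aeval ![X, Y] f₂ := by
  induction N generalizing f with
  | zero =>
    refine ⟨0, 1, f, by simp, fun h0 => ?_, by simp⟩
    have h := P.v_aeval_sub_pos (z := ![X, Y]) (s := ![a, b])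
      (fun i => by fin_cases i <;> simpa using ‹_›) f
    rw [h0, map_zero, sub_zero] at h
    exact absurd h (not_lt.2 hf)
  | succ N ih =>
    by_cases h0 : eval ![a, b] f = 0
    · obtain ⟨g, hg⟩ := sub_eval_mul_eq hq hXY (point_equation P hXY hX hY) f
      rw [h0, map_zero, sub_zero] at hg
      set u : MvPolynomial (Fin 2) K := 1 + (MvPolynomial.X 1 - C b) ^ (q - 1) with hu
      have hu1 : eval ![a, b] u = 1 := by
        simp [hu, zero_pow (show q - 1 ≠ 0 by omega)]
      have hu2 : aeval ![X, Y] u = 1 + (Y - algebraMap K F b) ^ (q - 1) := by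
        simp [hu]
      rw [← hu2] at hg
      have hv : P.v (aeval ![X, Y] f) =
          P.v (X - algebraMap K F a) + P.v (aeval ![X, Y] g) := by
        rw [← P.v.map_mul, ← hg, P.v.map_mul,
          v_aeval_eq_zero P hX hY (f := u) (by rw [hu1]; exact one_ne_zero), add_zero]
      have hgN : P.v (aeval ![X, Y] g) ≤ (N : ℤ) := by
        rw [hv] at hf
        revert hf hX
        generalize P.v (X - algebraMap K F a) = s
        generalize P.v (aeval ![X, Y] g) = t
        cases s with
        | top => intro _ h; simp at h
        | coe s =>
          cases t with
          | top => intro _ h; simp at h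
          | coe t =>
            intro h1 h2
            rw [← WithTop.coe_add, WithTop.coe_le_coe] at h2
            rw [← WithTop.coe_zero, WithTop.coe_lt_coe] at h1
            rw [WithTop.coe_le_coe]
            push_cast at h2
            omega
      obtain ⟨n, f₁, f₂, h1, h2, h⟩ := ih g hgN
      refine ⟨n + 1, u * f₁, f₂, by rw [map_mul, hu1, one_mul]; exact h1, h2, ?_⟩
      rw [map_mul, ← mul_assoc, hg, mul_assoc, h]
      ring
    · exact ⟨0, 1, f, by simp, h0, by simp⟩

include hq hq1 hXY hX hY in
-- The place `P` serves only to bound the number of factors stripped off. The resulting identity can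
-- be read at any place over (a, b), which is why the point determines the place.
theorem exists_local_form
    (hF : ∀ w : F, ∃ f g : MvPolynomial (Fin 2) K, aeval ![X, Y] g ≠ 0 ∧
      w * aeval ![X, Y] g = aeval ![X, Y] f) {w : F} (hw : w ≠ 0) :
    ∃ (i j : ℕ) (f₁ f₂ : MvPolynomial (Fin 2) K), eval ![a, b] f₁ ≠ 0 ∧ eval ![a, b] f₂ ≠ 0 ∧
      w * (X - algebraMap K F a) ^ i * aeval ![X, Y] f₁ =
        (X - algebraMap K F a) ^ j * aeval ![X, Y] f₂ := by
  have key : ∀ f : MvPolynomial (Fin 2) K, aeval ![X, Y] f ≠ 0 →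
      ∃ (n : ℕ) (f₁ f₂ : MvPolynomial (Fin 2) K), eval ![a, b] f₁ ≠ 0 ∧ eval ![a, b] f₂ ≠ 0 ∧
        aeval ![X, Y] f * aeval ![X, Y] f₁ =
          (X - algebraMap K F a) ^ n * aeval ![X, Y] f₂ := by
    intro f hf
    obtain ⟨t, ht⟩ := WithTop.ne_top_iff_exists.1 (P.v_ne_top hf)
    exact exists_local_form_of_le P hq hq1 hXY hX hY t.toNat f
      (by rw [← ht, WithTop.coe_le_coe]; exact Int.self_le_toNat t)
  obtain ⟨f, g, hg, hfg⟩ := hF w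
  obtain ⟨i, g₁, g₂, hg1, hg2, hgg⟩ := key g hg
  obtain ⟨j, f₁, f₂, hf1, hf2, hff⟩ := key f (hfg ▸ mul_ne_zero hw hg)
  refine ⟨i, j, g₂ * f₁, g₁ * f₂, ?_, ?_, ?_⟩
  · rw [map_mul]
    exact mul_ne_zero hg2 hf1
  · rw [map_mul]
    exact mul_ne_zero hg1 hf2
  · rw [map_mul, map_mul]
    linear_combination (-w * aeval ![X, Y] f₁) * hgg + (aeval ![X, Y] g₁) * hff +
      aeval ![X, Y] g₁ * aeval ![X, Y] f₁ * hfg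

variable (hF : ∀ w : F, ∃ f g : MvPolynomial (Fin 2) K, aeval ![X, Y] g ≠ 0 ∧
      w * aeval ![X, Y] g = aeval ![X, Y] f)

include hq hq1 hXY hX hY hF in
-- By the local form every finite value is a multiple of that of X - a, and the value 1 is attained.
theorem v_sub_eq_one (hXa : X - algebraMap K F a ≠ 0) : P.v (X - algebraMap K F a) = 1 := by
  obtain ⟨w, hw⟩ := P.surjective 1
  have hw0 : w ≠ 0 := by
    rintro rfl
    simp at hw
  obtain ⟨i, j, f₁, f₂, h1, h2, h⟩ := exists_local_form P hq hq1 hXY hX hY hF hw0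
  have hv := congrArg P.v h
  rw [P.v.map_mul, P.v.map_mul, P.v.map_mul, v_aeval_eq_zero P hX hY h1,
    v_aeval_eq_zero P hX hY h2, hw, P.v.map_pow, P.v.map_pow, add_zero, add_zero] at hv
  obtain ⟨t, ht⟩ := WithTop.ne_top_iff_exists.1 (P.v_ne_top hXa)
  rw [← ht] at hv hX ⊢
  rw [← WithTop.coe_nsmul, ← WithTop.coe_nsmul, ← WithTop.coe_one, ← WithTop.coe_add,
    WithTop.coe_inj, nsmul_eq_mul, nsmul_eq_mul] at hv
  have ht0 : 0 < t := WithTop.coe_lt_coe.1 hX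
  have hdvd : t ∣ 1 := ⟨j - i, by linear_combination hv⟩
  rw [Int.eq_one_of_dvd_one ht0.le hdvd]
  rfl

include hq hq1 hXY hX hY hF in
/-- A place of the Hermitian function field is determined by its point. -/
theorem place_eq_of_point (hXa : X - algebraMap K F a ≠ 0) (P' : FFPlace K F)
    (hX' : 0 < P'.v (X - algebraMap K F a)) (hY' : 0 < P'.v (Y - algebraMap K F b)) :
    P = P' := by
  refine FFPlace.ext (AddValuation.ext fun w => ?_)
  by_cases hw : w = 0
  · rw [hw, P.v.map_zero, P'.v.map_zero]
  obtain ⟨i, j, f₁, f₂, h1, h2, h⟩ := exists_local_form P hq hq1 hXY hX hY hF hw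
  have hv := congrArg P.v h
  have hv' := congrArg P'.v h
  rw [P.v.map_mul, P.v.map_mul, P.v.map_mul, v_aeval_eq_zero P hX hY h1,
    v_aeval_eq_zero P hX hY h2, P.v.map_pow, P.v.map_pow, add_zero, add_zero,
    v_sub_eq_one P hq hq1 hXY hX hY hF hXa] at hv
  rw [P'.v.map_mul, P'.v.map_mul, P'.v.map_mul, v_aeval_eq_zero P' hX' hY' h1,
    v_aeval_eq_zero P' hX' hY' h2, P'.v.map_pow, P'.v.map_pow, add_zero, add_zero,
    v_sub_eq_one P' hq hq1 hXY hX' hY' hF hXa, ← hv] at hv'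
  obtain ⟨s, hs⟩ := WithTop.ne_top_iff_exists.1 (P.v_ne_top hw)
  obtain ⟨t, ht⟩ := WithTop.ne_top_iff_exists.1 (P'.v_ne_top hw)
  rw [← hs, ← ht, ← WithTop.coe_one, ← WithTop.coe_nsmul, ← WithTop.coe_add, ← WithTop.coe_add,
    WithTop.coe_inj] at hv'
  rw [← hs, ← ht, WithTop.coe_inj]
  exact (add_right_cancel hv').symm

include hq hq1 hXY hX hY hF in
-- In the local form of a unit the powers of X - a cancel, leaving a quotient of polynomials
-- nonvanishing at (a, b); its residue is the quotient of their values there.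
theorem isRational_of_point (hXa : X - algebraMap K F a ≠ 0) : P.IsRational := by
  intro w hw
  by_cases hw0 : 0 < P.v w
  · exact ⟨0, by simpa using hw0⟩
  have hvw : P.v w = 0 := le_antisymm (not_lt.1 hw0) hw
  have hwne : w ≠ 0 := by
    rintro rfl
    simp at hw0
  obtain ⟨i, j, f₁, f₂, h1, h2, h⟩ := exists_local_form P hq hq1 hXY hX hY hF hwne
  have hv := congrArg P.v h
  rw [P.v.map_mul, P.v.map_mul, P.v.map_mul, v_aeval_eq_zero P hX hY h1,
    v_aeval_eq_zero P hX hY h2, P.v.map_pow, P.v.map_pow, add_zero, add_zero,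
    v_sub_eq_one P hq hq1 hXY hX hY hF hXa, hvw, zero_add, ← WithTop.coe_one,
    ← WithTop.coe_nsmul, ← WithTop.coe_nsmul, WithTop.coe_inj, nsmul_one, nsmul_one,
    Nat.cast_inj] at hv
  rw [hv, mul_comm w, mul_assoc] at h
  have h' := mul_left_cancel₀ (pow_ne_zero _ hXa) h
  set c₁ := eval ![a, b] f₁
  set c₂ := eval ![a, b] f₂
  have hpt : ∀ i : Fin 2, 0 < P.v (![X, Y] i - algebraMap K F (![a, b] i)) := fun i => by
    fin_cases i <;> simpa using ‹_›
  refine ⟨c₂ / c₁, ?_⟩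
  have e1 := P.v_aeval_sub_pos hpt (C c₁ * f₂ - C c₂ * f₁)
  have hz : eval ![a, b] (C c₁ * f₂ - C c₂ * f₁) = 0 := by
    rw [map_sub, map_mul, map_mul, eval_C, eval_C]
    ring
  rw [hz, map_zero, sub_zero] at e1
  have hc1 : algebraMap K F c₁ ≠ 0 := by simpa using h1
  have e2 : aeval ![X, Y] (C c₁ * f₂ - C c₂ * f₁) =
      (w - algebraMap K F (c₂ / c₁)) * (algebraMap K F c₁ * aeval ![X, Y] f₁) := by
    rw [map_sub, map_mul, map_mul, aeval_C, aeval_C, ← h', map_div₀]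
    field_simp
  rw [e2, P.v.map_mul, P.v.map_mul, P.trivial_on_constants _ h1, v_aeval_eq_zero P hX hY h1,
    add_zero, add_zero] at e1
  exact e1

end Local

end Hermitian

/-! ### Places from maximal ideals -/

open Classical IsDedekindDomain in
/-- The place given by a maximal ideal of a Dedekind domain containing the constants. -/
noncomputable def FFPlace.ofHeightOneSpectrum {K F D : Type*} [Field K] [Field F] [Algebra K F]
    [CommRing D] [IsDedekindDomain D] [Algebra D F] [IsFractionRing D F] [Algebra K D]
    [IsScalarTower K D F] (𝔭 : HeightOneSpectrum D) : FFPlace K F where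
  v := AddValuation.of
    (fun w : F => if w = 0 then (⊤ : WithTop ℤ) else ((-(𝔭.valuation F w).log : ℤ) : WithTop ℤ))
    (if_pos rfl)
    (by simp)
    (fun w w' => by
      by_cases hw : w = 0
      · simp [hw]
      by_cases hw' : w' = 0
      · simp [hw']
      by_cases hs : w + w' = 0
      · simp [hs]
      rw [if_neg hw, if_neg hw', if_neg hs, ← WithTop.coe_min, WithTop.coe_le_coe, min_neg_neg,
        neg_le_neg_iff]
      have h := (𝔭.valuation F).map_add w w'
      have h0 : 𝔭.valuation F w ≠ 0 := by simpa using hw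
      have h0' : 𝔭.valuation F w' ≠ 0 := by simpa using hw'
      have hs' : 𝔭.valuation F (w + w') ≠ 0 := by simpa using hs
      rcases le_max_iff.1 h with h | h
      · exact le_max_of_le_left ((WithZero.log_le_log hs' h0).2 h)
      · exact le_max_of_le_right ((WithZero.log_le_log hs' h0').2 h))
    (fun w w' => by
      by_cases hw : w = 0
      · simp [hw]
      by_cases hw' : w' = 0
      · simp [hw']
      have h0 : 𝔭.valuation F w ≠ 0 := by simpa using hw
      have h0' : 𝔭.valuation F w' ≠ 0 := by simpa using hw'
      rw [if_neg hw, if_neg hw', if_neg (mul_ne_zero hw hw'), map_mul, WithZero.log_mul h0 h0',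
        neg_add, WithTop.coe_add])
  surjective t := by
    cases t with
    | top => exact ⟨0, by simp⟩
    | coe t =>
      obtain ⟨w, hw⟩ := 𝔭.valuation_surjective F (WithZero.exp (-t))
      have hw0 : w ≠ 0 := by
        rintro rfl
        rw [map_zero] at hw
        exact WithZero.exp_ne_zero hw.symm
      refine ⟨w, ?_⟩
      rw [AddValuation.of_apply, if_neg hw0, hw, WithZero.log_exp, neg_neg]
  trivial_on_constants c hc := by
    have hle : ∀ d : K, 𝔭.valuation F (algebraMap K F d) ≤ 1 := fun d => by
      rw [IsScalarTower.algebraMap_apply K D F]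
      exact 𝔭.valuation_le_one _
    have h1 : 𝔭.valuation F (algebraMap K F c) = 1 := by
      refine le_antisymm (hle c) ?_
      have h := mul_le_mul_right (hle c⁻¹) (𝔭.valuation F (algebraMap K F c))
      rwa [← map_mul, ← map_mul, mul_inv_cancel₀ hc, map_one, map_one, mul_one] at h
    rw [AddValuation.of_apply, if_neg (by simpa using hc), h1, WithZero.log_one, neg_zero]
    rfl

open Classical IsDedekindDomain in
theorem FFPlace.ofHeightOneSpectrum_nonneg_iff {K F D : Type*} [Field K] [Field F] [Algebra K F]
    [CommRing D] [IsDedekindDomain D] [Algebra D F] [IsFractionRing D F] [Algebra K D]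
    [IsScalarTower K D F] (𝔭 : HeightOneSpectrum D) (w : F) :
    0 ≤ (FFPlace.ofHeightOneSpectrum (K := K) 𝔭).v w ↔ 𝔭.valuation F w ≤ 1 := by
  change (0 : WithTop ℤ) ≤
    (if w = 0 then (⊤ : WithTop ℤ) else ((-(𝔭.valuation F w).log : ℤ) : WithTop ℤ)) ↔ _
  by_cases hw : w = 0
  · simp [hw]
  · have h0 : 𝔭.valuation F w ≠ 0 := by simpa using hw
    rw [if_neg hw, ← WithTop.coe_zero, WithTop.coe_le_coe, Left.nonneg_neg_iff,
      WithZero.log_le_iff_le_exp h0, WithZero.exp_zero]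

/-! ### Behaviour at infinity -/

namespace Hermitian

section Infinity

variable {K F : Type*} [Field K] [Field F] [Algebra K F] {q : ℕ} {X Y : F} (P : FFPlace K F)

theorem v_nonneg_of_equation (hXY : Y ^ q + Y = X ^ (q + 1)) (hq1 : 1 < q) (hX : 0 ≤ P.v X) :
    0 ≤ P.v Y := by
  by_contra hY
  have hlt : P.v (Y ^ q) < P.v Y := by
    rw [P.v.map_pow]
    revert hY
    generalize P.v Y = t
    cases t with
    | top => simp
    | coe t =>
      intro h
      rw [← WithTop.coe_zero, WithTop.coe_le_coe] at h
      rw [← WithTop.coe_nsmul, WithTop.coe_lt_coe, nsmul_eq_mul]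
      have : (1 : ℤ) < q := by exact_mod_cast hq1
      nlinarith
  have h := congrArg P.v hXY
  rw [P.v.map_add_eq_of_lt_left hlt, P.v.map_pow X] at h
  have h0 : 0 ≤ P.v (Y ^ q) := h ▸ nsmul_nonneg hX _
  exact hY (h0.trans hlt.le)

/-- At a pole of X the term Y^q dominates Y, so q·v(Y) = (q+1)·v(X): both are negative and v(Y) is
the smaller. -/
theorem v_infinity (hXY : Y ^ q + Y = X ^ (q + 1)) (hq1 : 1 < q) (hX : P.v X < 0) :
    P.v Y < 0 ∧ 0 < P.v (X * Y⁻¹) ∧ 0 < P.v Y⁻¹ := by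
  have hq' : (1 : ℤ) < q := by exact_mod_cast hq1
  have hX0 : X ≠ 0 := by
    rintro rfl
    simp at hX
  have hY0 : Y ≠ 0 := by
    rintro rfl
    rw [zero_pow (by omega), add_zero] at hXY
    exact pow_ne_zero _ hX0 hXY.symm
  obtain ⟨s, hs⟩ := WithTop.ne_top_iff_exists.1 (P.v_ne_top hX0)
  obtain ⟨t, ht⟩ := WithTop.ne_top_iff_exists.1 (P.v_ne_top hY0)
  obtain ⟨t', ht'⟩ := WithTop.ne_top_iff_exists.1 (P.v_ne_top (inv_ne_zero hY0))
  have hinv := P.v_inv_add hY0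
  rw [← ht, ← ht', ← WithTop.coe_add, ← WithTop.coe_zero, WithTop.coe_inj] at hinv
  have hv := congrArg P.v hXY
  rw [← hs, ← WithTop.coe_zero, WithTop.coe_lt_coe] at hX
  rw [P.v.map_pow X, ← hs, ← WithTop.coe_nsmul, nsmul_eq_mul] at hv
  have ht0 : t < 0 := by
    by_contra hge
    have h0 : 0 ≤ P.v Y := by
      rw [← ht, ← WithTop.coe_zero, WithTop.coe_le_coe]
      omega
    have h1 : 0 ≤ P.v (Y ^ q + Y) :=
      P.v.map_le_add (by rw [P.v.map_pow]; exact nsmul_nonneg h0 _) h0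
    rw [hv, ← WithTop.coe_zero, WithTop.coe_le_coe] at h1
    push_cast at h1
    nlinarith
  have hlt : P.v (Y ^ q) < P.v Y := by
    rw [P.v.map_pow, ← ht, ← WithTop.coe_nsmul, WithTop.coe_lt_coe, nsmul_eq_mul]
    nlinarith
  rw [P.v.map_add_eq_of_lt_left hlt, P.v.map_pow, ← ht, ← WithTop.coe_nsmul, WithTop.coe_inj,
    nsmul_eq_mul] at hv
  rw [P.v.map_mul, ← hs, ← ht, ← ht', ← WithTop.coe_add, ← WithTop.coe_zero]
  simp only [WithTop.coe_lt_coe]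
  push_cast at hv
  refine ⟨ht0, ?_, by omega⟩
  nlinarith

/-- Horner's scheme: once a nonzero quotient is multiplied by Y the value is negative, and adding a
constant cannot change it. -/
theorem v_polynomial_aeval_nonpos (hY : P.v Y < 0) (f : Polynomial K) (hf : f ≠ 0) :
    P.v (Polynomial.aeval Y f) ≤ 0 := by
  induction hn : f.natDegree using Nat.strong_induction_on generalizing f with
  | _ n ih =>
    rw [← f.divX_mul_X_add, map_add, map_mul, Polynomial.aeval_X, Polynomial.aeval_C]
    by_cases h0 : f.divX = 0
    · rw [h0, map_zero, zero_mul, zero_add, P.trivial_on_constants]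
      intro hc
      rw [← f.divX_mul_X_add, h0, hc] at hf
      simp at hf
    · have hpos : f.natDegree ≠ 0 := fun hd => h0 (by
        rw [Polynomial.eq_C_of_natDegree_eq_zero hd, Polynomial.divX_C])
      have hlt : P.v (Polynomial.aeval Y f.divX * Y) < 0 := by
        rw [P.v.map_mul]
        refine lt_of_le_of_lt (add_le_of_nonpos_left (ih _ ?_ f.divX h0 rfl)) hY
        rw [Polynomial.natDegree_divX_eq_natDegree_tsub_one]
        omega
      rw [P.v.map_add_eq_of_lt_left (lt_of_lt_of_le hlt (P.v_algebraMap_nonneg _))]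
      exact hlt.le

end Infinity

/-! ### Generators of the function field, uniqueness of P_∞ and separation of places -/

section FunctionField

variable (K : Type*) [Field K] (q : ℕ)

open MvPolynomial in
theorem exists_aeval_eq (r : CoordinateRing K q) : ∃ f : MvPolynomial (Fin 2) K,
    aeval ![x K q, y K q] f = algebraMap (CoordinateRing K q) (FunctionField K q) r := by
  induction r using AdjoinRoot.induction_on with
  | ih f =>
    induction f using Polynomial.induction_on' with
    | add f g hf hg =>
      obtain ⟨f', hf⟩ := hf
      obtain ⟨g', hg⟩ := hg
      exact ⟨f' + g', by rw [map_add, map_add, map_add, hf, hg]⟩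
    | monomial n c =>
      have hc : ∃ g : MvPolynomial (Fin 2) K, aeval ![x K q, y K q] g =
          algebraMap (CoordinateRing K q) (FunctionField K q) (AdjoinRoot.of _ c) := by
        induction c using Polynomial.induction_on' with
        | add f g hf hg =>
          obtain ⟨f', hf⟩ := hf
          obtain ⟨g', hg⟩ := hg
          exact ⟨f' + g', by rw [map_add, map_add, map_add, hf, hg]⟩
        | monomial m c =>
          refine ⟨C c * X 1 ^ m, ?_⟩
          rw [← Polynomial.C_mul_X_pow_eq_monomial, map_mul, map_mul, map_mul, map_pow, map_pow,
            map_pow, aeval_X, aeval_C]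
          rfl
      obtain ⟨g, hg⟩ := hc
      refine ⟨g * X 0 ^ n, ?_⟩
      rw [← Polynomial.C_mul_X_pow_eq_monomial, map_mul, map_mul, map_mul, map_pow, map_pow,
        map_pow, aeval_X, hg]
      rfl

open MvPolynomial in
theorem exists_quotient_aeval [Fact (IsPrimePow q)] (w : FunctionField K q) :
    ∃ f g : MvPolynomial (Fin 2) K, aeval ![x K q, y K q] g ≠ 0 ∧
      w * aeval ![x K q, y K q] g = aeval ![x K q, y K q] f := by
  obtain ⟨r, s, hs, rfl⟩ := IsFractionRing.div_surjective (A := CoordinateRing K q) w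
  obtain ⟨f, hf⟩ := exists_aeval_eq K q r
  obtain ⟨g, hg⟩ := exists_aeval_eq K q s
  have hs0 : algebraMap (CoordinateRing K q) (FunctionField K q) s ≠ 0 :=
    IsFractionRing.to_map_ne_zero_of_mem_nonZeroDivisors hs
  refine ⟨f, g, hg ▸ hs0, ?_⟩
  rw [hf, hg, div_mul_cancel₀ _ hs0]

variable {K q}

open MvPolynomial in
theorem exists_aeval_infinity {F : Type*} [Field F] [Algebra K F] {X Y : F} (hY : Y ≠ 0)
    (f : MvPolynomial (Fin 2) K) : ∃ (n : ℕ) (g : MvPolynomial (Fin 2) K),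
      aeval ![X * Y⁻¹, Y⁻¹] g = aeval ![X, Y] f * Y⁻¹ ^ n := by
  induction f using MvPolynomial.induction_on with
  | C c => exact ⟨0, C c, by simp⟩
  | add f g hf hg =>
    obtain ⟨n, f', hf⟩ := hf
    obtain ⟨m, g', hg⟩ := hg
    refine ⟨n + m, f' * MvPolynomial.X 1 ^ m + g' * MvPolynomial.X 1 ^ n, ?_⟩
    simp only [map_add, map_mul, map_pow, aeval_X, hf, hg, Matrix.cons_val_one,
      Matrix.cons_val_fin_one]
    ring
  | mul_X f i hf =>
    obtain ⟨n, f', hf⟩ := hf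
    fin_cases i
    · refine ⟨n + 1, f' * MvPolynomial.X 0, ?_⟩
      simp only [map_mul, aeval_X, hf, Fin.zero_eta, Matrix.cons_val_zero]
      ring
    · refine ⟨n + 1, f', ?_⟩
      simp only [map_mul, aeval_X, hf, Fin.mk_one, Matrix.cons_val_one, Matrix.cons_val_fin_one]
      rw [pow_succ]
      field_simp

open MvPolynomial in
theorem exists_quotient_aeval_infinity [Fact (IsPrimePow q)] (hy : y K q ≠ 0)
    (w : FunctionField K q) :
    ∃ f g : MvPolynomial (Fin 2) K, aeval ![x K q * (y K q)⁻¹, (y K q)⁻¹] g ≠ 0 ∧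
      w * aeval ![x K q * (y K q)⁻¹, (y K q)⁻¹] g =
        aeval ![x K q * (y K q)⁻¹, (y K q)⁻¹] f := by
  obtain ⟨f, g, hg, hfg⟩ := exists_quotient_aeval K q w
  obtain ⟨n, f', hf'⟩ := exists_aeval_infinity (X := x K q) hy f
  obtain ⟨m, g', hg'⟩ := exists_aeval_infinity (X := x K q) hy g
  have hyi := inv_ne_zero hy
  refine ⟨f' * X 1 ^ m, g' * X 1 ^ n, ?_, ?_⟩
  · simp only [map_mul, map_pow, aeval_X, hg', Matrix.cons_val_one, Matrix.cons_val_fin_one]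
    exact mul_ne_zero (mul_ne_zero hg (pow_ne_zero _ hyi)) (pow_ne_zero _ hyi)
  · simp only [map_mul, map_pow, aeval_X, hf', hg', Matrix.cons_val_one, Matrix.cons_val_fin_one]
    rw [← hfg]
    ring

section Places

variable [hq : Fact (IsPrimePow q)]

theorem equation_infinity (hy : y K q ≠ 0) :
    (y K q)⁻¹ ^ q + (y K q)⁻¹ = (x K q * (y K q)⁻¹) ^ (q + 1) := by
  rw [mul_pow, ← equation, add_mul, pow_succ (y K q)⁻¹ q, ← mul_assoc, ← mul_pow,
    mul_inv_cancel₀ hy, one_pow, one_mul, mul_left_comm, mul_inv_cancel₀ hy, mul_one, add_comm]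

variable [Finite K]

theorem exists_char (hK : Nat.card K = q ^ 2) :
    ∃ p m : ℕ, Fact p.Prime ∧ CharP K p ∧ q = p ^ m := by
  obtain ⟨p, m, hp, hm, rfl⟩ := (isPrimePow_nat_iff q).1 hq.out
  have hpf : Fact p.Prime := ⟨hp⟩
  obtain ⟨p', hp'⟩ := CharP.exists K
  have hprime : p'.Prime := CharP.char_is_prime K p'
  have hfp' : Fact p'.Prime := ⟨hprime⟩
  have := Fintype.ofFinite K
  obtain ⟨n, -, hn⟩ := FiniteField.card K p'
  rw [← Nat.card_eq_fintype_card, hK, ← pow_mul] at hn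
  have hdvd : p' ∣ p := hprime.dvd_of_dvd_pow (hn ▸ dvd_pow_self p' n.2.ne')
  rw [(Nat.prime_dvd_prime_iff_eq hprime hp).1 hdvd] at hp'
  exact ⟨p, m, hpf, hp', rfl⟩

variable (hK : Nat.card K = q ^ 2)

include hK in
-- Every pole of x lies over the point (0, 0) in the coordinates x/y, 1/y, which satisfy the
-- Hermitian equation again.
theorem infinity_unique {P P' : FFPlace K (FunctionField K q)} (hP : P.v (x K q) < 0)
    (hP' : P'.v (x K q) < 0) : P = P' := by
  obtain ⟨p, m, _, _, hpm⟩ := exists_char hK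
  have : CharP (FunctionField K q) p :=
    charP_of_injective_algebraMap (algebraMap K (FunctionField K q)).injective p
  have hq1 := hq.out.one_lt
  obtain ⟨h1, h2, h3⟩ := v_infinity P (equation K q) hq1 hP
  obtain ⟨-, h2', h3'⟩ := v_infinity P' (equation K q) hq1 hP'
  have hx : x K q ≠ 0 := fun h => by simp [h] at hP
  have hy : y K q ≠ 0 := fun h => by simp [h] at h1
  refine place_eq_of_point P (a := 0) (b := 0) hpm hq1 (equation_infinity hy) (by simpa using h2)
    (by simpa using h3) (exists_quotient_aeval_infinity hy) (by simp [hx, hy]) P'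
    (by simpa using h2') (by simpa using h3')

include hK in
theorem infinity_isRational {P : FFPlace K (FunctionField K q)} (hP : P.v (x K q) < 0) :
    P.IsRational := by
  obtain ⟨p, m, _, _, hpm⟩ := exists_char hK
  have : CharP (FunctionField K q) p :=
    charP_of_injective_algebraMap (algebraMap K (FunctionField K q)).injective p
  have hq1 := hq.out.one_lt
  obtain ⟨h1, h2, h3⟩ := v_infinity P (equation K q) hq1 hP
  have hx : x K q ≠ 0 := fun h => by simp [h] at hP
  have hy : y K q ≠ 0 := fun h => by simp [h] at h1
  exact isRational_of_point P (a := 0) (b := 0) hpm hq1 (equation_infinity hy)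
    (by simpa using h2) (by simpa using h3) (exists_quotient_aeval_infinity hy)
    (by simp [hx, hy])

variable {Pinf : FFPlace K (FunctionField K q)} (hPinf : Pinf.v (x K q) < 0)

include hK hPinf in
theorem x_mem_regularAway : x K q ∈ Pinf.regularAway :=
  fun _ hQ => not_lt.1 fun h => hQ (infinity_unique hK h hPinf)

include hK hPinf in
theorem y_mem_regularAway : y K q ∈ Pinf.regularAway :=
  fun Q hQ => v_nonneg_of_equation Q (equation K q) hq.out.one_lt
    (x_mem_regularAway hK hPinf Q hQ)

include hK hPinf in
-- If (a, b) is the point of `R`, then x - a or y - b separates; otherwise `Q` would lie over the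
-- same point.
theorem exists_separating (Q R : FFPlace K (FunctionField K q))
    (hR : R.IsRational) (hRi : R ≠ Pinf) (hRQ : R ≠ Q) :
    ∃ g ∈ Pinf.regularAway, ¬ 0 < Q.v g ∧ 0 < R.v g := by
  obtain ⟨p, m, _, _, hpm⟩ := exists_char hK
  have : CharP (FunctionField K q) p :=
    charP_of_injective_algebraMap (algebraMap K (FunctionField K q)).injective p
  have hx := x_mem_regularAway hK hPinf
  have hy := y_mem_regularAway hK hPinf
  have hc : ∀ c : K, algebraMap K (FunctionField K q) c ∈ Pinf.regularAway :=
    fun c S _ => S.v_algebraMap_nonneg c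
  obtain ⟨a, ha⟩ := hR _ (hx R hRi)
  obtain ⟨b, hb⟩ := hR _ (hy R hRi)
  by_contra hcon
  push Not at hcon
  have ha' : 0 < Q.v (x K q - algebraMap K _ a) := by
    by_contra h
    exact (hcon _ (Submodule.sub_mem _ hx (hc a)) (not_lt.1 h)).not_gt ha
  have hb' : 0 < Q.v (y K q - algebraMap K _ b) := by
    by_contra h
    exact (hcon _ (Submodule.sub_mem _ hy (hc b)) (not_lt.1 h)).not_gt hb
  refine hRQ (place_eq_of_point R hpm hq.out.one_lt (equation K q) ha hb
    (exists_quotient_aeval K q) (fun h => ?_) Q ha' hb')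
  rw [sub_eq_zero.1 h] at hPinf
  exact absurd hPinf (not_lt.2 (Pinf.v_algebraMap_nonneg a))

end Places

end FunctionField

end Hermitian

/-! ### The Kummer extension of K(y), and the vanishing of L(-1) -/

theorem isSplittingField_X_pow_sub_C_of_adjoin_eq_top {E L : Type*} [Field E] [Field L]
    [Algebra E L] {n : ℕ} (hn : 0 < n) {ζ : E} (hζ : IsPrimitiveRoot ζ n) {a : E} {α : L}
    (hα : α ^ n = algebraMap E L a) (htop : IntermediateField.adjoin E {α} = ⊤) :
    (Polynomial.X ^ n - Polynomial.C a).IsSplittingField E L := by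
  have hint : IsIntegral E α :=
    ⟨Polynomial.X ^ n - Polynomial.C a, Polynomial.monic_X_pow_sub_C _ hn.ne', by simp [hα]⟩
  constructor
  · rw [Polynomial.map_sub, Polynomial.map_pow, Polynomial.map_C, Polynomial.map_X]
    exact X_pow_sub_C_splits_of_isPrimitiveRoot
      (hζ.map_of_injective (algebraMap E L).injective) hα
  · rw [eq_top_iff, ← IntermediateField.top_toSubalgebra, ← htop,
      IntermediateField.adjoin_simple_toSubalgebra_of_isAlgebraic hint.isAlgebraic]
    refine Algebra.adjoin_mono ?_
    rw [Set.singleton_subset_iff, Polynomial.mem_rootSet_of_ne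
      (Polynomial.X_pow_sub_C_ne_zero hn a)]
    simp [hα]

namespace Hermitian

section Integral

variable {K : Type*} [Field K] {q : ℕ} [hq : Fact (IsPrimePow q)]

omit hq in
theorem algebraMap_polynomial_apply (f : Polynomial K) :
    algebraMap (Polynomial K) (FunctionField K q) f = Polynomial.aeval (y K q) f := by
  have h : (IsScalarTower.toAlgHom K (Polynomial K) (FunctionField K q)) =
      Polynomial.aeval (y K q) := by
    refine Polynomial.algHom_ext ?_
    rw [Polynomial.aeval_X]
    exact IsScalarTower.algebraMap_apply (Polynomial K) (CoordinateRing K q) (FunctionField K q) _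
  exact DFunLike.congr_fun h f

instance : FaithfulSMul (Polynomial K) (FunctionField K q) := by
  rw [faithfulSMul_iff_algebraMap_injective,
    IsScalarTower.algebraMap_eq (Polynomial K) (CoordinateRing K q) (FunctionField K q)]
  refine (IsFractionRing.injective (CoordinateRing K q) (FunctionField K q)).comp ?_
  refine AdjoinRoot.of.injective_of_degree_ne_zero ?_
  rw [polynomial, Polynomial.degree_X_pow_sub_C (Nat.succ_pos q)]
  exact_mod_cast Nat.succ_ne_zero q

attribute [local instance] FractionRing.liftAlgebra

theorem adjoin_x_eq_top :
    IntermediateField.adjoin (FractionRing (Polynomial K)) {x K q} = ⊤ := by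
  rw [eq_top_iff]
  intro w _
  have hy : y K q ∈ IntermediateField.adjoin (FractionRing (Polynomial K)) {x K q} := by
    have h := (IntermediateField.adjoin (FractionRing (Polynomial K)) {x K q}).algebraMap_mem
      (algebraMap (Polynomial K) _ Polynomial.X)
    rwa [← IsScalarTower.algebraMap_apply, algebraMap_polynomial_apply, Polynomial.aeval_X] at h
  have hx := IntermediateField.mem_adjoin_simple_self (FractionRing (Polynomial K)) (x K q)
  have hmem : ∀ f : MvPolynomial (Fin 2) K, MvPolynomial.aeval ![x K q, y K q] f ∈
      IntermediateField.adjoin (FractionRing (Polynomial K)) {x K q} := by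
    intro f
    induction f using MvPolynomial.induction_on with
    | C c =>
      have h := (IntermediateField.adjoin (FractionRing (Polynomial K)) {x K q}).algebraMap_mem
        (algebraMap (Polynomial K) _ (Polynomial.C c))
      rwa [← IsScalarTower.algebraMap_apply, algebraMap_polynomial_apply, Polynomial.aeval_C,
        ← MvPolynomial.aeval_C ![x K q, y K q]] at h
    | add f g hf hg =>
      rw [map_add]
      exact add_mem hf hg
    | mul_X f i hf =>
      rw [map_mul, MvPolynomial.aeval_X]
      refine mul_mem hf ?_
      fin_cases i
      · exact hx
      · exact hy
  obtain ⟨f, g, hg, hfg⟩ := exists_quotient_aeval K q w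
  rw [← div_eq_iff hg |>.2 hfg.symm]
  exact div_mem (hmem f) (hmem g)

/-- The extension is obtained by adjoining a (q+1)-th root x of y^q + y. Since q + 1 divides q² - 1,
the constants contain the (q+1)-th roots of unity, and q + 1 = 1 in K makes the polynomial
separable. -/
theorem isGalois_and_finite [Finite K] (hK : Nat.card K = q ^ 2) {δ : K}
    (hδ : IsPrimitiveRoot δ (q ^ 2 - 1)) :
    IsGalois (FractionRing (Polynomial K)) (FunctionField K q) ∧
      FiniteDimensional (FractionRing (Polynomial K)) (FunctionField K q) := by
  have hq1 := hq.out.one_lt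
  obtain ⟨p, m, _, _, hpm⟩ := exists_char hK
  set E := FractionRing (Polynomial K) with hE
  have hinj : Function.Injective (algebraMap K E) := (algebraMap K E).injective
  have hfac : q ^ 2 - 1 = (q - 1) * (q + 1) := by
    obtain ⟨k, rfl⟩ := Nat.exists_eq_add_of_lt hq1
    simp only [Nat.add_sub_cancel]
    rw [Nat.sub_eq_iff_eq_add (Nat.one_le_pow _ _ (by omega))]
    ring_nf
  have hζ : IsPrimitiveRoot (algebraMap K E (δ ^ (q - 1))) (q + 1) :=
    (hδ.pow (by rw [hfac]; exact Nat.mul_pos (by omega) (by omega)) hfac).map_of_injective hinj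
  set a : E := algebraMap (Polynomial K) E (Polynomial.X ^ q + Polynomial.X) with ha
  have hxa : x K q ^ (q + 1) = algebraMap E (FunctionField K q) a := by
    rw [ha, ← IsScalarTower.algebraMap_apply, algebraMap_polynomial_apply, ← equation]
    simp
  have ha0 : a ≠ 0 := by
    rw [ha, Ne, map_eq_zero_iff _ (IsFractionRing.injective (Polynomial K) E)]
    intro h
    have h1 := congrArg (fun f => Polynomial.coeff f 1) h
    simp [Polynomial.coeff_X_pow, hq1.ne] at h1
  have hn0 : ((q + 1 : ℕ) : E) ≠ 0 := by
    have hqK : (q : K) = 0 := by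
      rw [CharP.cast_eq_zero_iff K p, hpm]
      refine dvd_pow_self p ?_
      rintro rfl
      rw [pow_zero] at hpm
      omega
    have : ((q + 1 : ℕ) : K) = 1 := by rw [Nat.cast_add, hqK, zero_add, Nat.cast_one]
    rw [← map_natCast (algebraMap K E), this, map_one]
    exact one_ne_zero
  have hsplit : (Polynomial.X ^ (q + 1) - Polynomial.C a).IsSplittingField E (FunctionField K q) :=
    isSplittingField_X_pow_sub_C_of_adjoin_eq_top q.succ_pos hζ hxa adjoin_x_eq_top
  exact ⟨IsGalois.of_separable_splitting_field (Polynomial.separable_X_pow_sub_C a hn0 ha0),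
    Polynomial.IsSplittingField.finiteDimensional (FunctionField K q)
      (Polynomial.X ^ (q + 1) - Polynomial.C a)⟩

/-- The integral closure of K[y] is a Dedekind domain, hence the intersection of its localizations
at maximal ideals; each of these is the local ring of a place other than P_∞. -/
theorem isIntegral_of_mem_regularAway [Finite K] (hK : Nat.card K = q ^ 2) {δ : K}
    (hδ : IsPrimitiveRoot δ (q ^ 2 - 1)) {Pinf : FFPlace K (FunctionField K q)}
    (hPinf : Pinf.v (x K q) < 0) {w : FunctionField K q} (hw : w ∈ Pinf.regularAway) :
    IsIntegral (Polynomial K) w := by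
  obtain ⟨_, _⟩ := isGalois_and_finite hK hδ
  set D := integralClosure (Polynomial K) (FunctionField K q) with hD
  have : IsFractionRing D (FunctionField K q) :=
    IsIntegralClosure.isFractionRing_of_finite_extension (Polynomial K)
      (FractionRing (Polynomial K)) (FunctionField K q) D
  have : IsDedekindDomain D :=
    integralClosure.isDedekindDomain (Polynomial K) (FractionRing (Polynomial K))
      (L := FunctionField K q)
  have hmem : w ∈ (algebraMap D (FunctionField K q)).range := by
    refine IsDedekindDomain.HeightOneSpectrum.mem_integers_of_valuation_le_one _ _ fun 𝔭 => ?_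
    rw [← FFPlace.ofHeightOneSpectrum_nonneg_iff (K := K) 𝔭]
    refine hw _ ?_
    -- A place coming from a maximal ideal has y regular, whereas y has a pole at P_∞.
    rintro rfl
    obtain ⟨hy, -, -⟩ := v_infinity _ (equation K q) hq.out.one_lt hPinf
    refine absurd hy (not_lt.2 ((FFPlace.ofHeightOneSpectrum_nonneg_iff (K := K) 𝔭 _).2 ?_))
    have hyD : y K q ∈ D := by
      have h := isIntegral_algebraMap (R := Polynomial K) (A := FunctionField K q)
        (x := Polynomial.X)
      rwa [algebraMap_polynomial_apply, Polynomial.aeval_X] at h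
    exact 𝔭.valuation_le_one (⟨y K q, hyD⟩ : D)
  obtain ⟨d, rfl⟩ := hmem
  exact d.2

/-- The norm is integral over K[y] and lies in K(y), so it is a polynomial in y. As the product of
conjugates that all vanish at P_∞ it has positive value there, which only the zero polynomial can
have. -/
theorem eq_zero_of_isIntegral [Finite K] (hK : Nat.card K = q ^ 2) {δ : K}
    (hδ : IsPrimitiveRoot δ (q ^ 2 - 1)) {Pinf : FFPlace K (FunctionField K q)}
    (hPinf : Pinf.v (x K q) < 0) {w : FunctionField K q} (hw : IsIntegral (Polynomial K) w)
    (hv : 0 < Pinf.v w) : w = 0 := by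
  obtain ⟨_, _⟩ := isGalois_and_finite hK hδ
  obtain ⟨hy, -, -⟩ := v_infinity _ (equation K q) hq.out.one_lt hPinf
  obtain ⟨f, hf⟩ := IsIntegrallyClosed.isIntegral_iff.1
    (Algebra.isIntegral_norm (FractionRing (Polynomial K)) hw)
  have hprod := Algebra.norm_eq_prod_automorphisms (FractionRing (Polynomial K)) w
  rw [← hf, ← IsScalarTower.algebraMap_apply, algebraMap_polynomial_apply] at hprod
  have hconj : ∀ τ : Gal(FunctionField K q/FractionRing (Polynomial K)), 0 < Pinf.v (τ w) := by
    intro τ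
    have hτy : τ (y K q) = y K q := by
      have h := τ.commutes (algebraMap (Polynomial K) _ Polynomial.X)
      rwa [← IsScalarTower.algebraMap_apply, algebraMap_polynomial_apply,
        Polynomial.aeval_X] at h
    set τ' : FunctionField K q ≃ₐ[K] FunctionField K q := τ.restrictScalars K
    -- The automorphism fixes y, so it sends P_∞ to a pole of y, and a pole of y is a pole of x.
    have heq : τ'⁻¹ • Pinf = Pinf := by
      refine infinity_unique hK ?_ hPinf
      by_contra hx
      have h := v_nonneg_of_equation _ (equation K q) hq.out.one_lt (not_lt.1 hx)
      rw [FFPlace.smul_v_apply, inv_inv, show τ' (y K q) = y K q from hτy] at h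
      exact absurd hy (not_lt.2 h)
    have h := FFPlace.smul_v_apply τ'⁻¹ Pinf w
    rw [heq, inv_inv] at h
    rw [h] at hv
    exact hv
  have hf0 : f = 0 := by
    by_contra hf0
    have hle := v_polynomial_aeval_nonpos Pinf hy f hf0
    rw [hprod] at hle
    have hlt : ∀ s : Finset (Gal(FunctionField K q/FractionRing (Polynomial K))), s.Nonempty →
        0 < Pinf.v (∏ τ ∈ s, τ w) := by
      intro s hs
      induction hs using Finset.Nonempty.cons_induction with
      | singleton τ => simpa using hconj τ
      | cons τ s h hs ih =>
        rw [Finset.prod_cons, Pinf.v.map_mul]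
        exact lt_of_lt_of_le (hconj τ) (le_add_of_nonneg_right ih.le)
    exact absurd (hlt _ Finset.univ_nonempty) (not_lt.2 hle)
  rw [hf0, map_zero] at hf
  exact Algebra.norm_eq_zero_iff.1 hf.symm

theorem regularAway_inf_eq_bot [Finite K] (hK : Nat.card K = q ^ 2) {δ : K}
    (hδ : IsPrimitiveRoot δ (q ^ 2 - 1)) {Pinf : FFPlace K (FunctionField K q)}
    (hPinf : Pinf.v (x K q) < 0) : Pinf.regularAway ⊓ Pinf.geSubmodule 1 = ⊥ := by
  rw [eq_bot_iff]
  exact fun w hw => (Submodule.mem_bot K).2 (eq_zero_of_isIntegral hK hδ hPinf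
    (isIntegral_of_mem_regularAway hK hδ hPinf hw.1) (FFPlace.mem_geSubmodule_one.1 hw.2))

end Integral

end Hermitian

/-! ### Orbits of a cyclic group, and pole orders of polynomial expressions -/

section Orbits

open MulAction

variable {G α : Type*} [Group G] [MulAction G α]

theorem pow_smul_injective_of_ncard_orbit {g : G} {a : α} {L : ℕ}
    (h : (orbit (Subgroup.zpowers g) a).ncard = L) {i j : ℕ} (hi : i < L) (hj : j < L)
    (hij : g ^ i • a = g ^ j • a) : i = j := by
  have hL : Function.minimalPeriod (g • ·) a = L := by
    rw [← h, ← Nat.card_coe_set_eq, Nat.card_congr (orbitZPowersEquiv g a), Nat.card_zmod]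
  refine Function.iterate_injOn_Iio_minimalPeriod (f := (g • ·)) (x := a) (hL ▸ hi) (hL ▸ hj) ?_
  change (g • ·)^[i] a = (g • ·)^[j] a
  rw [smul_iterate, smul_iterate]
  exact hij

theorem orbit_zpowers_eq_of_pow_smul_eq {g : G} {a b : α} {i j : ℕ}
    (h : g ^ i • a = g ^ j • b) :
    orbit (Subgroup.zpowers g) a = orbit (Subgroup.zpowers g) b := by
  have hmem : ∀ (k : ℕ) (c : α), g ^ k • c ∈ orbit (Subgroup.zpowers g) c :=
    fun k c => ⟨⟨g ^ k, Subgroup.npow_mem_zpowers g k⟩, rfl⟩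
  rw [← orbit_eq_iff.2 (hmem i a), h, orbit_eq_iff.2 (hmem j b)]

theorem pow_smul_ne_of_smul_eq {g : G} {a b : α} {L : ℕ} (hL : 1 < L) (hb : g • b = b)
    (h : (orbit (Subgroup.zpowers g) a).ncard = L) (i : ℕ) : g ^ i • a ≠ b := by
  intro hi
  have h1 : g ^ (1 : ℕ) • b = g ^ (0 : ℕ) • b := by rw [pow_one, pow_zero, one_smul, hb]
  have h0 : g ^ i • a = g ^ 0 • b := by rw [hi, pow_zero, one_smul]
  rw [orbit_zpowers_eq_of_pow_smul_eq h0] at h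
  exact one_ne_zero (pow_smul_injective_of_ncard_orbit h hL (by omega) h1)

end Orbits

namespace FFPlace

variable {K F : Type*} [Field K] [Field F] [Algebra K F]

theorem IsRational.smul {P : FFPlace K F} (hP : P.IsRational) (σ : F ≃ₐ[K] F) :
    (σ • P).IsRational := by
  intro z hz
  obtain ⟨c, hc⟩ := hP _ hz
  refine ⟨c, ?_⟩
  rwa [smul_v_apply, map_sub, AlgEquiv.commutes]

theorem neg_mul_le_nsmul {r d c : ℕ} (hd : d ≤ r) {t : WithTop ℤ}
    (ht : ((-(c : ℤ) : ℤ) : WithTop ℤ) ≤ t) :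
    ((-((r * c : ℕ) : ℤ) : ℤ) : WithTop ℤ) ≤ d • t := by
  cases t with
  | top =>
    rcases Nat.eq_zero_or_pos d with rfl | h
    · rw [zero_nsmul, ← WithTop.coe_zero, WithTop.coe_le_coe]
      omega
    · obtain ⟨d, rfl⟩ := Nat.exists_eq_succ_of_ne_zero h.ne'
      rw [succ_nsmul, add_top]
      exact le_top
  | coe t =>
    rw [WithTop.coe_le_coe] at ht
    rw [← WithTop.coe_nsmul, WithTop.coe_le_coe, nsmul_eq_mul]
    push_cast
    have : (d : ℤ) ≤ r := by exact_mod_cast hd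
    nlinarith

/-- The bound holds for each monomial, because its exponents are at most `r`, and constants have
nonnegative value. -/
theorem neg_le_v_aeval (P : FFPlace K F) {ι : Type*} [Fintype ι] {z : ι → F} {c : ι → ℕ}
    (hz : ∀ i, ((-(c i : ℤ) : ℤ) : WithTop ℤ) ≤ P.v (z i)) {r : ℕ} {f : MvPolynomial ι K}
    (hf : ∀ i, f.degreeOf i ≤ r) :
    ((-((r * ∑ i, c i : ℕ) : ℤ) : ℤ) : WithTop ℤ) ≤ P.v (MvPolynomial.aeval z f) := by
  rw [MvPolynomial.aeval_def, MvPolynomial.eval₂_eq']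
  refine P.v.map_le_sum fun d hd => ?_
  have hprod : ∀ s : Finset ι, ((-((r * ∑ i ∈ s, c i : ℕ) : ℤ) : ℤ) : WithTop ℤ) ≤
      P.v (∏ i ∈ s, z i ^ d i) := by
    classical
    intro s
    induction s using Finset.induction_on with
    | empty => simp
    | insert i s hi ih =>
      rw [Finset.sum_insert hi, Finset.prod_insert hi, P.v.map_mul, P.v.map_pow, mul_add,
        Nat.cast_add, neg_add, WithTop.coe_add]
      exact add_le_add (neg_mul_le_nsmul
        ((MvPolynomial.monomial_le_degreeOf i hd).trans (hf i)) (hz i)) ih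
  rw [P.v.map_mul]
  exact (hprod _).trans (le_add_of_nonneg_left (P.v_algebraMap_nonneg _))

end FFPlace

/-! ### The auxiliary function of a recursion -/

namespace Hermitian

section Sequences

variable {q : ℕ} [hqp : Fact (IsPrimePow q)] {K : Type*} [Field K] [Finite K]
  (hK : Nat.card K = q ^ 2) {N M : ℕ} {δ : K} (hδ : IsPrimitiveRoot δ (q ^ 2 - 1))
  {σ : FunctionField K q ≃ₐ[K] FunctionField K q} (hσx : σ (x K q) = δ • x K q)
  {Pinf : FFPlace K (FunctionField K q)} (hPinf : Pinf.v (x K q) < 0)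

include hqp in
theorem one_lt_sq_sub_one : 1 < q ^ 2 - 1 := by
  have := hqp.out.one_lt
  have : 2 ^ 2 ≤ q ^ 2 := Nat.pow_le_pow_left this 2
  omega

include hK hδ hσx hPinf in
-- σ multiplies x by a nonzero constant, so it sends a pole of x to a pole of x.
theorem smul_infinity : σ • Pinf = Pinf := by
  refine infinity_unique hK ?_ hPinf
  have hδ0 : δ ≠ 0 := hδ.ne_zero (by have := one_lt_sq_sub_one (q := q); omega)
  have h : σ⁻¹ (x K q) = δ⁻¹ • x K q := by
    rw [AlgEquiv.aut_inv, AlgEquiv.symm_apply_eq, map_smul, hσx, smul_smul, inv_mul_cancel₀ hδ0,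
      one_smul]
  rwa [FFPlace.smul_v_apply, h, Algebra.smul_def, Pinf.v.map_mul,
    Pinf.trivial_on_constants _ (inv_ne_zero hδ0), zero_add]

include hK hδ hσx hPinf in
/-- A recursion of degree at most `r` in each variable for the values of `z` along `M` blocks of
length `B` in each of `N` families of `σ`-orbits forces the function
`σ⁻ᵘ(z) - f(z, σ⁻¹(z), …)` to have `N * M * (B - u)` zeros. -/
theorem card_zeros_le_of_recursion {P : FFPlace K (FunctionField K q)}
    {Q : Fin N → Fin M → FFPlace K (FunctionField K q)}
    (hP : P.IsRational) (hQ : ∀ i l, (Q i l).IsRational)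
    (hPorb : (MulAction.orbit (Subgroup.zpowers σ) P).ncard = q ^ 2 - 1)
    (hQorb : ∀ i l, (MulAction.orbit (Subgroup.zpowers σ) (Q i l)).ncard = q ^ 2 - 1)
    (hPQ : ∀ i l, MulAction.orbit (Subgroup.zpowers σ) (Q i l) ≠
      MulAction.orbit (Subgroup.zpowers σ) P)
    (hQQ : ∀ i l i' l', MulAction.orbit (Subgroup.zpowers σ) (Q i l) =
      MulAction.orbit (Subgroup.zpowers σ) (Q i' l') → i = i' ∧ l = l')
    {z : FunctionField K q} {k : ℕ}
    (hzP : P.v z = ((-1 : ℤ) : WithTop ℤ)) (hzi : ((-(k : ℤ) : ℤ) : WithTop ℤ) ≤ Pinf.v z)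
    (hz : ∀ R, R ≠ P → R ≠ Pinf → 0 ≤ R.v z)
    {r u B : ℕ} (hu : u < q ^ 2 - 1) (hB : B ≤ q ^ 2 - 1) (f : MvPolynomial (Fin u) K)
    (hf : ∀ t, f.degreeOf t ≤ r)
    (hrec : ∀ i l j, j + u < B → (σ ^ (j + u) • Q i l).eval z =
      MvPolynomial.eval (fun t : Fin u => (σ ^ (j + t) • Q i l).eval z) f) :
    N * M * (B - u) ≤ max k (r * (u * k)) + (r * u + 1) := by
  classical
  have hfix := smul_infinity hK hδ hσx hPinf
  have hL := one_lt_sq_sub_one (q := q)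
  have hfixpow : ∀ t : ℕ, σ ^ t • Pinf = Pinf := by
    intro t
    induction t with
    | zero => rw [pow_zero, one_smul]
    | succ t ih => rw [pow_succ, mul_smul, hfix, ih]
  have hPi : ∀ t : ℕ, σ ^ t • P ≠ Pinf := pow_smul_ne_of_smul_eq hL hfix hPorb
  have hQi : ∀ i l (t : ℕ), σ ^ t • Q i l ≠ Pinf := fun i l =>
    pow_smul_ne_of_smul_eq hL hfix (hQorb i l)
  have hval : ∀ (R : FFPlace K (FunctionField K q)) (t : ℕ) (w : FunctionField K q),
      R.v ((σ ^ t)⁻¹ w) = (σ ^ t • R).v w := fun R t w => (FFPlace.smul_v_apply _ _ _).symm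
  -- The poles of σ⁻ᵗ(z) lie among σ⁻ᵗ(P) and P_∞, and the σ⁻ˢ(P) with s < q² - 1 are distinct.
  have hpole : ∀ s t : ℕ, s < q ^ 2 - 1 → t < q ^ 2 - 1 → s ≠ t →
      0 ≤ ((σ ^ s)⁻¹ • P).v ((σ ^ t)⁻¹ z) := by
    intro s t hs ht hst
    rw [hval]
    refine hz _ (fun h => hst ?_) (fun h => ?_)
    · have h' := congrArg (fun R => σ ^ s • R) h
      simp only [smul_smul, ← mul_assoc, ← pow_add] at h'
      rw [add_comm, pow_add, mul_inv_cancel_right] at h'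
      exact pow_smul_injective_of_ncard_orbit hPorb hs ht h'.symm
    · have h' := congrArg (fun R => σ ^ s • R) h
      simp only [smul_smul, ← mul_assoc, ← pow_add] at h'
      rw [add_comm, pow_add, mul_inv_cancel_right, hfixpow] at h'
      exact hPi t h'
  have hpole' : ∀ t : ℕ, ((σ ^ t)⁻¹ • P).v ((σ ^ t)⁻¹ z) = ((-1 : ℤ) : WithTop ℤ) := by
    intro t
    rw [hval, smul_inv_smul, hzP]
  set g : Fin u → FunctionField K q := fun t => (σ ^ (t : ℕ))⁻¹ z with hg
  set h := (σ ^ u)⁻¹ z - MvPolynomial.aeval g f with hh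
  have hreg : ∀ R : FFPlace K (FunctionField K q), (∀ t, 0 ≤ R.v (g t)) →
      0 ≤ R.v (MvPolynomial.aeval g f) := by
    intro R hR
    have := R.neg_le_v_aeval (c := fun _ => 0) (z := g) (by simpa using hR) hf
    simpa using this
  -- At σ⁻ᵘ(P) the first term has a pole and all arguments of `f` are regular; this is where u < q²
  -- - 1 matters.
  have hne : h ≠ 0 := by
    intro h0
    have h1 := hreg ((σ ^ u)⁻¹ • P) fun t => hpole u t hu (t.2.trans hu) t.2.ne'
    rw [← sub_eq_zero.1 h0, hpole', ← WithTop.coe_zero, WithTop.coe_le_coe] at h1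
    omega
  set p : ℕ → FFPlace K (FunctionField K q) := fun t => (σ ^ t)⁻¹ • P with hp
  have hpinj : ∀ s t : ℕ, s < q ^ 2 - 1 → t < q ^ 2 - 1 → p s = p t → s = t := by
    intro s t hs ht hst
    by_contra hne
    have h1 := hpole s t hs ht hne
    rw [show (σ ^ s)⁻¹ • P = (σ ^ t)⁻¹ • P from hst, hpole', ← WithTop.coe_zero,
      WithTop.coe_le_coe] at h1
    omega
  set E := (Finset.range (u + 1)).image p with hE
  set e : FFPlace K (FunctionField K q) → ℕ := fun R => if R = p u then 1 else r with he
  have hpu : ∀ s, s < u → p s ≠ p u := fun s hs h =>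
    hs.ne (hpinj s u (hs.trans hu) hu h)
  have hsum : ∑ R ∈ E, e R = r * u + 1 := by
    rw [hE, Finset.sum_image, Finset.sum_range_succ]
    · rw [Finset.sum_congr rfl (g := fun _ => r) fun s hs => by
        simp [he, hpu s (Finset.mem_range.1 hs)]]
      simp [he, mul_comm]
    · intro s hs t ht
      have hs := Finset.mem_range.1 hs
      have ht := Finset.mem_range.1 ht
      exact hpinj s t (by omega) (by omega)
  set ζ : Fin N × Fin M × Fin (B - u) → FFPlace K (FunctionField K q) :=
    fun a => σ ^ (a.2.2 : ℕ) • Q a.1 a.2.1 with hζ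
  have hζinj : Function.Injective ζ := by
    rintro ⟨i, l, j⟩ ⟨i', l', j'⟩ hij
    obtain ⟨rfl, rfl⟩ := hQQ i l i' l' (orbit_zpowers_eq_of_pow_smul_eq hij)
    have := pow_smul_injective_of_ncard_orbit (hQorb i l) (by omega) (by omega) hij
    rw [show j = j' from Fin.ext this]
  have hcard : (Finset.univ.image ζ).card = N * M * (B - u) := by
    rw [Finset.card_image_of_injective _ hζinj]
    simp [mul_assoc]
  have hzero : ∀ a, 0 < (ζ a).v h := by
    rintro ⟨i, l, j⟩
    -- The value of σ⁻ᵗ(z) at σʲ(Q_{i,l}) is the sequence entry with index j + t in the block.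
    have hv : ∀ t : ℕ, 0 < (σ ^ (j : ℕ) • Q i l).v ((σ ^ t)⁻¹ z -
        algebraMap K _ ((σ ^ ((j : ℕ) + t) • Q i l).eval z)) := by
      intro t
      have hnp : 0 ≤ (σ ^ ((j : ℕ) + t) • Q i l).v z := by
        refine hz _ (fun h => hPQ i l ?_) (hQi i l _)
        refine orbit_zpowers_eq_of_pow_smul_eq (i := j + t) (j := 0) ?_
        rw [h, pow_zero, one_smul]
      have h1 := FFPlace.v_eval_sub_pos ((hQ i l).smul (σ ^ ((j : ℕ) + t))) hnp
      rw [add_comm, pow_add, mul_smul, FFPlace.smul_v_apply, map_sub, AlgEquiv.commutes] at h1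
      rwa [add_comm, pow_add, mul_smul]
    have h1 := hv u
    have h2 := (σ ^ (j : ℕ) • Q i l).v_aeval_sub_pos (z := g)
      (s := fun t => (σ ^ ((j : ℕ) + t) • Q i l).eval z) (fun t => hv t) f
    rw [hrec i l j (by omega)] at h1
    have h3 := lt_of_lt_of_le (lt_min h1 h2) (AddValuation.map_sub _ _ _)
    rwa [sub_sub_sub_cancel_right] at h3
  have key := FFPlace.card_zeros_le (infinity_isRational hK hPinf)
    (regularAway_inf_eq_bot hK hδ hPinf) (exists_separating hK hPinf) hne
    (Finset.univ.image ζ) E e (max k (r * (u * k))) ?_ ?_ ?_ ?_ ?_ ?_ ?_ ?_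
  · rwa [hcard, hsum] at key
  · intro R hR
    obtain ⟨s, -, rfl⟩ := Finset.mem_image.1 hR
    exact hP.smul _
  · intro hR
    obtain ⟨s, -, hs⟩ := Finset.mem_image.1 hR
    refine hPi 0 ?_
    rw [pow_zero, one_smul, ← hfixpow s, ← hs, smul_inv_smul]
  · intro R hR
    obtain ⟨a, -, rfl⟩ := Finset.mem_image.1 hR
    exact (hQ _ _).smul _
  · intro hR
    obtain ⟨a, -, ha⟩ := Finset.mem_image.1 hR
    exact hQi _ _ _ ha
  · intro R hR
    obtain ⟨a, -, rfl⟩ := Finset.mem_image.1 hR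
    exact hzero a
  · have hki : ∀ t : ℕ, ((-(k : ℤ) : ℤ) : WithTop ℤ) ≤ Pinf.v ((σ ^ t)⁻¹ z) := by
      intro t
      rw [hval, hfixpow]
      exact hzi
    have h2 := Pinf.neg_le_v_aeval (c := fun _ => k) (fun t : Fin u => hki t) hf
    rw [Finset.sum_const, Finset.card_univ, Fintype.card_fin, smul_eq_mul] at h2
    refine le_trans (le_min (le_trans ?_ (hki u)) (le_trans ?_ h2)) (Pinf.v.map_sub _ _)
    · exact WithTop.coe_le_coe.2 (by have := le_max_left k (r * (u * k)); omega)
    · exact WithTop.coe_le_coe.2 (by have := le_max_right k (r * (u * k)); omega)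
  · intro R hR
    obtain ⟨s, hs, rfl⟩ := Finset.mem_image.1 hR
    rcases (Nat.lt_succ_iff.1 (Finset.mem_range.1 hs)).lt_or_eq with hsu | rfl
    · have hes : e (p s) = r := if_neg (hpu s hsu)
      -- At σ⁻ˢ(P) only the variable number s has a pole, and a simple one, so the degree in that
      -- variable alone bounds the pole order.
      have h2 := (p s).neg_le_v_aeval (c := fun t : Fin u => if t = ⟨s, hsu⟩ then 1 else 0)
        (z := g) (fun t => ?_) hf
      · rw [Finset.sum_ite_eq', if_pos (Finset.mem_univ _), mul_one] at h2
        rw [hes]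
        refine le_trans (le_min (le_trans ?_ (hpole s u (hsu.trans hu) hu hsu.ne)) h2)
          ((p s).v.map_sub _ _)
        rw [← WithTop.coe_zero, WithTop.coe_le_coe]
        omega
      · by_cases hts : t = ⟨s, hsu⟩
        · rw [if_pos hts, hts]
          exact (hpole' s).ge
        · rw [if_neg hts]
          refine le_trans (by simp) (hpole s t (hsu.trans hu) (t.2.trans hu) fun h => hts ?_)
          exact Fin.ext h.symm
    · have hes : e (p s) = 1 := if_pos rfl
      rw [hes]
      refine le_trans (le_min (hpole' s).ge (le_trans ?_
        (hreg _ fun t => hpole s t hu (t.2.trans hu) t.2.ne'))) ((p s).v.map_sub _ _)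
      rw [← WithTop.coe_zero, WithTop.coe_le_coe]
      omega
  · intro R hR hRi
    have h0 : ∀ t : ℕ, t < u + 1 → 0 ≤ R.v ((σ ^ t)⁻¹ z) := by
      intro t ht
      rw [hval]
      refine hz _ (fun h => hR ?_) (fun h => hRi ?_)
      · refine Finset.mem_image.2 ⟨t, Finset.mem_range.2 ht, ?_⟩
        rw [hp, ← h]
        exact inv_smul_smul _ _
      · rw [← hfixpow t] at h
        exact smul_left_cancel _ h
    exact le_trans (le_min (h0 u (by omega)) (hreg R fun t => h0 t (by omega)))
      (R.v.map_sub _ _)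

end Sequences

end Hermitian

/-! ### From zero counting to the complexity bounds -/

theorem jointNonlinearComplexity_cases {K ι : Type*} [CommRing K] {n r : ℕ} (S : ι → Fin n → K) :
    ((∀ i j, S i j = 0) ∧ jointNonlinearComplexity r S = 0) ∨
      JointlyGenerated r S (jointNonlinearComplexity r S) ∧ 1 ≤ jointNonlinearComplexity r S ∨
      jointNonlinearComplexity r S = n := by
  classical
  rw [jointNonlinearComplexity]
  split_ifs with h0 h
  · exact Or.inl ⟨h0, rfl⟩
  · have hs := Nat.find_spec h
    exact Or.inr (Or.inl ⟨hs.2, hs.1⟩)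
  · exact Or.inr (Or.inr rfl)

namespace Hermitian

theorem truncateSeq_multisequence_apply {K F : Type*} [Field K] [Field F] [Algebra K F]
    {N M q n : ℕ} (σ : F ≃ₐ[K] F) (Q : Fin N → Fin M → FFPlace K F) (z : F)
    (hn : n ≤ M * (q ^ 2 - 1)) (i : Fin N) (l : Fin M) {j : ℕ} (hj : j < q ^ 2 - 1)
    (h : (l : ℕ) * (q ^ 2 - 1) + j < n) :
    truncateSeq (multisequence q σ Q z) n hn i ⟨l * (q ^ 2 - 1) + j, h⟩ =
      (σ ^ j • Q i l).eval z := by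
  have hmod : (Fin.castLE hn ⟨l * (q ^ 2 - 1) + j, h⟩).modNat.val = j := by
    change (l * (q ^ 2 - 1) + j) % (q ^ 2 - 1) = j
    rw [add_comm, Nat.add_mul_mod_self_right, Nat.mod_eq_of_lt hj]
  have hdiv : (Fin.castLE hn ⟨l * (q ^ 2 - 1) + j, h⟩).divNat = l := by
    apply Fin.ext
    change (l * (q ^ 2 - 1) + j) / (q ^ 2 - 1) = l
    rw [add_comm, Nat.add_mul_div_right _ _ (by omega),
      Nat.div_eq_of_lt hj, zero_add]
  rw [truncateSeq, multisequence, hmod, hdiv]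

section Complexity

variable {q : ℕ} [hqp : Fact (IsPrimePow q)] {K : Type*} [Field K] [Finite K]
  (hK : Nat.card K = q ^ 2) {N M : ℕ} {δ : K} (hδ : IsPrimitiveRoot δ (q ^ 2 - 1))
  {σ : FunctionField K q ≃ₐ[K] FunctionField K q} (hσx : σ (x K q) = δ • x K q)
  {Pinf : FFPlace K (FunctionField K q)} (hPinf : Pinf.v (x K q) < 0)

include hK hδ hσx hPinf in
-- A common form of both parts: the first `B` terms of each of the first `m` blocks are used, and
-- recursions reaching across two blocks are ignored.
theorem complexity_bound {P : FFPlace K (FunctionField K q)}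
    {Q : Fin N → Fin M → FFPlace K (FunctionField K q)}
    (hP : P.IsRational) (hQ : ∀ i l, (Q i l).IsRational)
    (hPorb : (MulAction.orbit (Subgroup.zpowers σ) P).ncard = q ^ 2 - 1)
    (hQorb : ∀ i l, (MulAction.orbit (Subgroup.zpowers σ) (Q i l)).ncard = q ^ 2 - 1)
    (hPQ : ∀ i l, MulAction.orbit (Subgroup.zpowers σ) (Q i l) ≠
      MulAction.orbit (Subgroup.zpowers σ) P)
    (hQQ : ∀ i l i' l', MulAction.orbit (Subgroup.zpowers σ) (Q i l) =
      MulAction.orbit (Subgroup.zpowers σ) (Q i' l') → i = i' ∧ l = l')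
    {z : FunctionField K q} {k : ℤ}
    (hk : k ≤ 2 * (((q : ℤ) ^ 2 - q) / 2) - 1)
    (hz : FFPlace.IsPoleDivisor z (Finsupp.single Pinf k + Finsupp.single P 1))
    {r : ℕ} (hr : 1 ≤ r) {n : ℕ} (hn : n ≤ M * (q ^ 2 - 1)) {m B : ℕ} (hm : m ≤ M) (hm1 : 1 ≤ m)
    (hB : B ≤ q ^ 2 - 1) (hmB : ∀ l < m, l * (q ^ 2 - 1) + B ≤ n)
    (hne : q ^ 2 - q < N * m * B ∨ ∃ i j, truncateSeq (multisequence q σ Q z) n hn i j ≠ 0) :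
    N * m * B ≤
      jointNonlinearComplexity r (truncateSeq (multisequence q σ Q z) n hn) *
        (N * m + (q ^ 2 - q) * r) + 1 := by
  classical
  set S := truncateSeq (multisequence q σ Q z) n hn with hS
  have hL := one_lt_sq_sub_one (q := q)
  have hPne : P ≠ Pinf := by
    have := pow_smul_ne_of_smul_eq hL (smul_infinity hK hδ hσx hPinf) hPorb 0
    rwa [pow_zero, one_smul] at this
  obtain ⟨hz0, hpole⟩ := hz
  simp only [FFPlace.poleOrder, Finsupp.add_apply, Finsupp.single_apply] at hpole
  have hlift : ∀ R : FFPlace K (FunctionField K q), ∃ t : ℤ, R.v z = (t : WithTop ℤ) ∧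
      ((if Pinf = R then k else 0) + if P = R then 1 else 0) = max 0 (-t) := by
    intro R
    obtain ⟨t, ht⟩ := WithTop.ne_top_iff_exists.1 (R.v_ne_top hz0)
    refine ⟨t, ht.symm, ?_⟩
    rw [hpole R, ← ht, WithTop.untopD_coe]
  have hzP : P.v z = ((-1 : ℤ) : WithTop ℤ) := by
    obtain ⟨t, ht, h⟩ := hlift P
    rw [if_neg hPne.symm, if_pos rfl] at h
    rw [ht, WithTop.coe_inj]
    omega
  have hzR : ∀ R, R ≠ P → R ≠ Pinf → 0 ≤ R.v z := by
    intro R hRP hRi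
    obtain ⟨t, ht, h⟩ := hlift R
    rw [if_neg hRi.symm, if_neg hRP.symm] at h
    rw [ht, ← WithTop.coe_zero, WithTop.coe_le_coe]
    omega
  obtain ⟨s, hs, hsk⟩ := hlift Pinf
  rw [if_pos rfl, if_neg hPne, add_zero] at hsk
  obtain ⟨k', rfl⟩ := Int.eq_ofNat_of_zero_le (show 0 ≤ k by omega)
  have hzi : ((-(k' : ℤ) : ℤ) : WithTop ℤ) ≤ Pinf.v z := by
    rw [hs, WithTop.coe_le_coe]
    omega
  have hqq : q ≤ q ^ 2 := Nat.le_self_pow two_ne_zero q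
  -- k + 1 ≤ 2g = q² - q.
  have hk' : k' + 1 ≤ q ^ 2 - q := by
    zify [hqq]
    omega
  have hcore := fun {u : ℕ} (hu : u < q ^ 2 - 1) (f : MvPolynomial (Fin u) K)
      (hf : ∀ t, f.degreeOf t ≤ r) (hrec : _) =>
    card_zeros_le_of_recursion (M := m) hK hδ hσx hPinf (Q := fun i l => Q i (Fin.castLE hm l)) hP
    (fun i l => hQ i _) hPorb (fun i l => hQorb i _) (fun i l => hPQ i _)
    (fun i l i' l' h => ⟨(hQQ _ _ _ _ h).1, Fin.castLE_injective hm (hQQ _ _ _ _ h).2⟩)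
    hzP hzi hzR hu hB f hf hrec
  have happ : ∀ (i : Fin N) (l : Fin m) (j : ℕ) (hj : j < B) (h : (l : ℕ) * (q ^ 2 - 1) + j < n),
      S i ⟨l * (q ^ 2 - 1) + j, h⟩ = (σ ^ j • Q i (Fin.castLE hm l)).eval z :=
    fun i l j hj h => truncateSeq_multisequence_apply σ Q z hn i (Fin.castLE hm l)
      (hj.trans_le hB) h
  have hlt : ∀ (l : Fin m) (j : ℕ), j < B → (l : ℕ) * (q ^ 2 - 1) + j < n := fun l j hj => by
    have := hmB l l.2
    omega
  rcases jointNonlinearComplexity_cases (r := r) S with ⟨h0, -⟩ | ⟨hgen, hu1⟩ | hu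
  · exfalso
    refine hne.elim (fun hlt' => ?_) fun ⟨i, j, hij⟩ => hij (h0 i j)
    -- All-zero sequences satisfy the recursion of order 0 with f = 0, where h = z: then z has NmB
    -- zeros and at most k + 1 ≤ q² - q poles, against the first alternative of `hne`.
    have h := hcore (u := 0) (by omega) 0 (fun t => t.elim0) fun i l j hj => by
      rw [map_zero, ← happ i l (j + 0) hj (hlt l _ hj), h0]
    simp only [mul_zero, zero_mul, zero_add, Nat.sub_zero, max_eq_left (Nat.zero_le _)] at h
    omega
  · set u := jointNonlinearComplexity r S
    -- For u ≥ B no recursion fits in a block, but then NmB ≤ Nmu already suffices.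
    rcases Nat.lt_or_ge u B with huB | huB
    · obtain ⟨f, hf, hgen⟩ := hgen
      have h := hcore (u := u) (by omega) f hf fun i l j hj => by
        have h1 := hgen i (l * (q ^ 2 - 1) + j) (by have := hlt l _ hj; omega)
        rw [← happ i l (j + u) hj (hlt l _ hj)]
        simp only [← fun t : Fin u => happ i l (j + t) (by omega) (hlt l _ (by omega))]
        simp only [add_assoc] at h1
        exact h1
      -- Here r ≥ 1 and u ≥ 1 are needed: the pole of f(z, …) at P_∞ is then allowed at least the
      -- order k of the first term.
      have hmax : max k' (r * (u * k')) = r * (u * k') :=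
        max_eq_right (by
          calc k' = 1 * (1 * k') := by ring
            _ ≤ r * (u * k') := Nat.mul_le_mul hr (Nat.mul_le_mul_right _ hu1))
      rw [hmax] at h
      obtain ⟨d, rfl⟩ := Nat.exists_eq_add_of_lt huB
      rw [show u + d + 1 - u = d + 1 by omega] at h
      have h3 := Nat.mul_le_mul_left (r * u) hk'
      nlinarith
    · have := Nat.mul_le_mul_left (N * m) huB
      nlinarith [Nat.zero_le (u * ((q ^ 2 - q) * r))]
  · rw [hu]
    have hBn : B ≤ n := by
      have := hmB 0 hm1
      omega
    have := Nat.mul_le_mul_left (N * m) hBn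
    nlinarith [Nat.zero_le (n * ((q ^ 2 - q) * r))]

end Complexity

end Hermitian

theorem theorem2
    -- the prime power `q ≥ 5` and the field `K` with `q ^ 2` elements
    {q : ℕ} [Fact (IsPrimePow q)] (hq : 5 ≤ q)
    {K : Type*} [Field K] [Finite K] (hK : Nat.card K = q ^ 2)
    {N M : ℕ} (hN : 0 < N) (hM : 0 < M) (hNM : N * M = q - 1)
    -- the automorphism `σ = φ_{δ,0,0}`, for a primitive element `δ` of `K`
    {δ : K} (hδ : IsPrimitiveRoot δ (q ^ 2 - 1))
    (σ : Hermitian.FunctionField K q ≃ₐ[K] Hermitian.FunctionField K q)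
    (hσx : σ (Hermitian.x K q) = δ • Hermitian.x K q)
    (hσy : σ (Hermitian.y K q) = δ ^ (q + 1) • Hermitian.y K q)
    -- the pole `P_∞` of `x`
    (Pinf : FFPlace K (Hermitian.FunctionField K q))
    (hPinf : Pinf.v (Hermitian.x K q) < 0)
    -- rational places representing the `q = N M + 1` orbits of length `q ^ 2 - 1`
    (P : FFPlace K (Hermitian.FunctionField K q))
    (Q : Fin N → Fin M → FFPlace K (Hermitian.FunctionField K q))
    (hP : P.IsRational) (hQ : ∀ i l, (Q i l).IsRational)
    (hPorb : (MulAction.orbit (Subgroup.zpowers σ) P).ncard = q ^ 2 - 1)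
    (hQorb : ∀ i l, (MulAction.orbit (Subgroup.zpowers σ) (Q i l)).ncard = q ^ 2 - 1)
    (hPQ : ∀ i l, MulAction.orbit (Subgroup.zpowers σ) (Q i l) ≠
      MulAction.orbit (Subgroup.zpowers σ) P)
    (hQQ : ∀ i l i' l', MulAction.orbit (Subgroup.zpowers σ) (Q i l) =
      MulAction.orbit (Subgroup.zpowers σ) (Q i' l') → i = i' ∧ l = l')
    -- the function `z` with `(z)_∞ = k P_∞ + P`, `k ≤ 2 g - 1`, `g = (q ^ 2 - q) / 2`
    (z : Hermitian.FunctionField K q) (k : ℤ)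
    (hk : k ≤ 2 * (((q : ℤ) ^ 2 - q) / 2) - 1)
    (hz : FFPlace.IsPoleDivisor z (Finsupp.single Pinf k + Finsupp.single P 1))
    (r : ℕ) (hr1 : 1 ≤ r) (hr2 : r ≤ q ^ 2 - 1)
    (n : ℕ) (hn1 : 1 < n) (hn2 : n ≤ M * (q ^ 2 - 1)) :
    (n ≤ q ^ 2 - 1 →
      (q ^ 2 - q < n * N ∨
        ∃ i j, truncateSeq (Hermitian.multisequence q σ Q z) n hn2 i j ≠ 0) →
      ((n : ℝ) * N - 1) / (N + ((q : ℝ) ^ 2 - q) * r) ≤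
        jointNonlinearComplexity r (truncateSeq (Hermitian.multisequence q σ Q z) n hn2)) ∧
    (q ^ 2 - 1 ≤ n →
      (((q : ℝ) ^ 2 - 1) * N * ((n / (q ^ 2 - 1) : ℕ) : ℝ) - 1) /
          (N * ((n / (q ^ 2 - 1) : ℕ) : ℝ) + ((q : ℝ) ^ 2 - q) * r) ≤
        jointNonlinearComplexity r
          (truncateSeq (Hermitian.multisequence q σ Q z) n hn2)) := by
  have hqq : q ≤ q ^ 2 := Nat.le_self_pow two_ne_zero q
  have hq1 : 1 ≤ q ^ 2 := Nat.one_le_pow _ _ (by omega)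
  have hL : 1 < q ^ 2 - 1 := Hermitian.one_lt_sq_sub_one
  have hcast : ((q ^ 2 - q : ℕ) : ℝ) = (q : ℝ) ^ 2 - q := by push_cast [hqq]; ring
  have hcast1 : ((q ^ 2 - 1 : ℕ) : ℝ) = (q : ℝ) ^ 2 - 1 := by push_cast [hq1]; ring
  have hN' : (0 : ℝ) < N := by exact_mod_cast hN
  have hqr : (0 : ℝ) ≤ ((q : ℝ) ^ 2 - q) * r := by
    rw [← hcast]
    positivity
  constructor
  · intro hnL hne
    have h := Hermitian.complexity_bound hK hδ hσx hPinf hP hQ hPorb hQorb hPQ hQQ hk hz hr1 hn2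
      (m := 1) (B := n) hM le_rfl hnL (fun l hl => by simp [Nat.lt_one_iff.1 hl])
      (by rwa [mul_one, mul_comm N n])
    rw [div_le_iff₀ (by linarith)]
    have h' := (Nat.cast_le (α := ℝ)).2 h
    simp only [Nat.cast_mul, Nat.cast_add, Nat.cast_one, hcast] at h'
    linarith
  · intro hLn
    set m := n / (q ^ 2 - 1) with hm
    have hm1 : 1 ≤ m := (Nat.one_le_div_iff (by omega)).2 hLn
    have h := Hermitian.complexity_bound hK hδ hσx hPinf hP hQ hPorb hQorb hPQ hQQ hk hz hr1 hn2
      (m := m) (B := q ^ 2 - 1) (Nat.div_le_of_le_mul (by rwa [mul_comm])) hm1 le_rfl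
      (fun l hl => by
        have h1 : (l + 1) * (q ^ 2 - 1) ≤ m * (q ^ 2 - 1) := Nat.mul_le_mul_right _ hl
        have h2 := Nat.div_mul_le_self n (q ^ 2 - 1)
        rw [add_mul, one_mul] at h1
        rw [← hm] at h2
        omega)
      -- One full block already has q² - 1 > q² - q terms, so the second part needs no nonvanishing
      -- assumption.
      (Or.inl (by
        have h1 : 1 * (q ^ 2 - 1) ≤ N * m * (q ^ 2 - 1) :=
          Nat.mul_le_mul_right _ (Nat.mul_pos hN hm1)
        omega))
    have hm' : (0 : ℝ) < m := by exact_mod_cast hm1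
    rw [div_le_iff₀ (by nlinarith [mul_pos hN' hm'])]
    have h' := (Nat.cast_le (α := ℝ)).2 h
    simp only [Nat.cast_mul, Nat.cast_add, Nat.cast_one, hcast, hcast1] at h'
    linarith
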